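/- Let $\ell\ge 3$, let $K$ be the $(2\ell+1)\times(2\ell+1)$ matrix with ones on the anti-diagonal and zeroes elsewhere, and let $G=\mathrm{SO}_{2\ell+1}(\mathbb C)=\{g\in \mathrm{SL}_{2\ell+1}(\mathbb C) : g=(Kg^{-1}K)^T\}$, a group of type $B_\ell$. Let $A$ be its diagonal torus. Identify $X_*(A)$ with $\mathbb Z^\ell$, where $a=(a_1,\dots,a_\ell)$ is the cocharacter $z\mapsto \mathrm{Diag}(z^{a_1},\dots,z^{a_\ell},1,z^{-a_\ell},\dots,z^{-a_1})$, and $V=X_*(A)\otimes\mathbb R$ with $\mathbb R^\ell$. The simple roots are $\gamma_k=e_k-e_{k+1}$ ($1\le k<\ell$) and $\gamma_\ell=e_\ell$, the highest root is $\tilde\gamma_0=\gamma_1+2\gamma_2+\dots+2\gamma_\ell$, and $\gamma_0=1-\tilde\gamma_0$ is the affine node of the affine Dynkin diagram. Put $b_0=b_1=1$, $b_k=2$ for $2\le k\le \ell$, $v_0=0$ and $v_k=\frac1{b_k}(e_1+\dots+e_k)$ for $1\le k\le\ell$; these are the vertices of the closed alcove $\bar C=\{x\in V:\gamma_k(x)\ge0\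 (1\le k\le\ell),\ \tilde\gamma_0(x)\le1\}$. Let $g\in G$ have finite order $m$ and let $\xi$ be a primitive $m$-th root of unity. A Kac diagram of $g$ (with respect to $\xi$) is a labelling of the nodes $\gamma_0,\dots,\gamma_\ell$ obtained as follows: choose $h\in G$ and $a\in X_*(A)$ such that $h^{-1}gh=a(\xi)$ and $a/m\in\bar C$, write $a/m=\frac1m\sum_{k=0}^{\ell}r_kb_kv_k$ with integers $r_k\ge0$ and $m=\sum_{k=0}^\ell r_kb_k$, and divide all $r_k$ by their greatest common divisor. For $1\le k<\ell$ let $s_k\in G$ be the permutation matrix that interchanges the indices $k,k+1$ and the indices $2\ell-k+1,2\ell-k+2$. Let $t_\ell\in G$ be the matrix that interchanges the indices $\ell,\ell+2$, has entry $-1$ at $(\ell+1,\ell+1)$, and is the identity elsewhere. For $1\le k<\ell$ put $t_k=s_ks_{k+1}\cdots s_{\ell-1}\,t_\ell\, s_{\ell-1}\cdots s_{k+1}s_k$. For a partition $\vec\ell=(\ell_\mu\ge\dots\ge\ell_1)$ of $\ell$ put $\ell'_\nu=\ell_1+\dots+\ell_{\nu-1}$ and $$n_{\vec\ell}=\prod_{\nu=1}^{\mu}\bigl(s_{\ell'_\nu+1}s_{\ell'_\nu+2}\cdots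 s_{\ell'_\nu+\ell_\nu-1}\,t_{\ell'_\nu+\ell_\nu}\bigr)\in G,$$ the product being taken in the order $\nu=1,2,\dots,\mu$. (This is the standard representative in $G$ of the elliptic conjugacy class of the Weyl group that is attached to $\vec\ell$.) Lemma. Fix a partition $\vec\ell=(\ell_\mu\ge\dots\ge\ell_1)$ of $\ell\ge3$ and let $m=2\,\mathrm{lcm}(\ell_1,\dots,\ell_\mu)$. Append $\lceil\mu/2\rceil$ copies of $m/2$ and $\lfloor\mu/2\rfloor$ zeroes to the list $\bigl(a\,m/(2\ell_\nu) : 1\le\nu\le\mu,\ 1\le a\le\ell_\nu-1\bigr)$, and arrange the result in decreasing order $\sigma_1\ge\sigma_2\ge\dots\ge\sigma_\ell$. Then, with respect to every primitive $m$-th root of unity, the element $n_{\vec\ell}$ (which has order $m$) has exactly one Kac diagram. It is obtained from the labels $$m-(\sigma_1+\sigma_2)\ \text{on } \gamma_0,\qquad \sigma_k-\sigma_{k+1}\ \text{on } \gamma_k\ (1\le k\le\ell-1),\qquad \sigma_\ell\ \text{on } \gamma_\ell$$ by dividing all of them by their greatest common divisor. -/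

import Mathlib

/-! Kac diagrams of finite order elements in the complex group `SO_{2ℓ+1}` of type `B_ℓ`.
Matrix rows and columns are numbered `1, …, 2ℓ+1` in the comments; the index `i : Fin (2 * ℓ + 1)`
stands for row `i + 1`.  The nodes `γ₀, γ₁, …, γ_ℓ` of the affine Dynkin diagram are indexed by
`Fin (ℓ + 1)`, with `0` the affine node. -/

namespace KacB

open Matrix

abbrev Mat (ℓ : ℕ) := Matrix (Fin (2 * ℓ + 1)) (Fin (2 * ℓ + 1)) ℂ

abbrev SL (ℓ : ℕ) := Matrix.SpecialLinearGroup (Fin (2 * ℓ + 1)) ℂ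

/-- The matrix with ones on the anti-diagonal and zeroes elsewhere. -/
def K (ℓ : ℕ) : Mat ℓ :=
  Matrix.of fun i j => if (i : ℕ) + j = 2 * ℓ then 1 else 0

theorem K_eq (ℓ : ℕ) : K ℓ = (Fin.revPerm : Equiv.Perm (Fin (2 * ℓ + 1))).permMatrix ℂ := by
  ext i j
  simp only [K, Matrix.of_apply, Equiv.Perm.permMatrix, Equiv.toPEquiv_apply,
    PEquiv.toMatrix_apply, Fin.revPerm_apply, Option.mem_some_iff, Fin.ext_iff, Fin.val_rev]
  congr 1
  exact propext ⟨fun h => by omega, fun h => by omega⟩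

theorem K_mul_K (ℓ : ℕ) : K ℓ * K ℓ = 1 := by
  rw [K_eq, ← Matrix.permMatrix_mul]
  have : (Fin.revPerm : Equiv.Perm (Fin (2 * ℓ + 1))) * Fin.revPerm = 1 := by
    ext i; simp
  rw [this, Matrix.permMatrix_one]

theorem K_transpose (ℓ : ℕ) : (K ℓ)ᵀ = K ℓ := by
  ext i j
  simp [K, add_comm]

/-- `SO_{2ℓ+1}(ℂ)`, realized as those `g` in `SL_{2ℓ+1}(ℂ)` with `g = (K g⁻¹ K)ᵀ`. -/
def SO (ℓ : ℕ) : Subgroup (SL ℓ) where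
  carrier := {g | (g : Mat ℓ) = (K ℓ * ((g⁻¹ : SL ℓ) : Mat ℓ) * K ℓ)ᵀ}
  one_mem' := by simp [K_transpose, K_mul_K]
  mul_mem' := by
    intro a b ha hb
    simp only [Set.mem_ofPred_eq] at ha hb ⊢
    rw [_root_.mul_inv_rev, Matrix.SpecialLinearGroup.coe_mul, Matrix.SpecialLinearGroup.coe_mul]
    conv_lhs => rw [ha, hb]
    rw [← Matrix.transpose_mul]
    congr 1
    calc K ℓ * ((b⁻¹ : SL ℓ) : Mat ℓ) * K ℓ * (K ℓ * ((a⁻¹ : SL ℓ) : Mat ℓ) * K ℓ)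
        = K ℓ * ((b⁻¹ : SL ℓ) : Mat ℓ) * (K ℓ * K ℓ) * ((a⁻¹ : SL ℓ) : Mat ℓ) * K ℓ := by simp only [Matrix.mul_assoc]
      _ = _ := by rw [K_mul_K, Matrix.mul_one]; simp only [Matrix.mul_assoc]
  inv_mem' := by
    intro a ha
    simp only [Set.mem_ofPred_eq, inv_inv] at ha ⊢
    conv_rhs => rw [ha]
    simp only [Matrix.transpose_mul, Matrix.transpose_transpose, K_transpose]
    calc ((a⁻¹ : SL ℓ) : Mat ℓ) = 1 * ((a⁻¹ : SL ℓ) : Mat ℓ) * 1 := by simp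
      _ = K ℓ * K ℓ * ((a⁻¹ : SL ℓ) : Mat ℓ) * (K ℓ * K ℓ) := by rw [K_mul_K]
      _ = _ := by simp only [Matrix.mul_assoc]

theorem mem_SO_of {ℓ : ℕ} {M : Mat ℓ} (hd : M.det = 1)
    (h : M * (K ℓ * Mᵀ * K ℓ) = 1) :
    (⟨M, hd⟩ : SL ℓ) ∈ SO ℓ := by
  set g : SL ℓ := ⟨M, hd⟩ with hg
  have h1 : ((g⁻¹ : SL ℓ) : Mat ℓ) * M = 1 := by
    have : ((g⁻¹ * g : SL ℓ) : Mat ℓ) = 1 := by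
      rw [inv_mul_cancel, Matrix.SpecialLinearGroup.coe_one]
    rwa [Matrix.SpecialLinearGroup.coe_mul] at this
  have h2 : ((g⁻¹ : SL ℓ) : Mat ℓ) = K ℓ * Mᵀ * K ℓ := left_inv_eq_right_inv h1 h
  change M = (K ℓ * ((g⁻¹ : SL ℓ) : Mat ℓ) * K ℓ)ᵀ
  rw [h2]
  have : K ℓ * (K ℓ * Mᵀ * K ℓ) * K ℓ = Mᵀ := by
    calc _ = (K ℓ * K ℓ) * Mᵀ * (K ℓ * K ℓ) := by simp only [Matrix.mul_assoc]
      _ = Mᵀ := by simp [K_mul_K]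
  rw [this, Matrix.transpose_transpose]

/-! ### The Weyl group representatives -/

/-- The matrix `s_k` (for `1 ≤ k < ℓ`): it interchanges `k, k+1` and `2ℓ-k+1, 2ℓ-k+2`. -/
def sMat (ℓ k : ℕ) : Mat ℓ :=
  Matrix.of fun i j =>
    let r := (i : ℕ) + 1
    let c := (j : ℕ) + 1
    if r = c ∧ r ∉ ({k, k + 1, 2 * ℓ - k + 2, 2 * ℓ - k + 1} : Finset ℕ) then 1
    else if r ≠ c ∧ r ∈ ({k, k + 1} : Finset ℕ) ∧ c ∈ ({k, k + 1} : Finset ℕ) then 1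
    else if r ≠ c ∧ r ∈ ({2 * ℓ - k + 1, 2 * ℓ - k + 2} : Finset ℕ) ∧
      c ∈ ({2 * ℓ - k + 1, 2 * ℓ - k + 2} : Finset ℕ) then 1
    else 0

/-- The matrix `t_ℓ` (for `1 ≤ ℓ`): it interchanges `ℓ, ℓ+2` and has `-1` at `ℓ+1`. -/
def tMat (ℓ : ℕ) : Mat ℓ :=
  Matrix.of fun i j =>
    let r := (i : ℕ) + 1
    let c := (j : ℕ) + 1
    if r = c ∧ (r < ℓ ∨ ℓ + 2 < r) then 1
    else if r ≠ c ∧ r ∈ ({ℓ, ℓ + 2} : Finset ℕ) ∧ c ∈ ({ℓ, ℓ + 2} : Finset ℕ) then 1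
    else if r = ℓ + 1 ∧ c = ℓ + 1 then -1
    else 0

/-- The permutation of the indices behind `s_k`. -/
def sPerm {ℓ k : ℕ} (h1 : 1 ≤ k) (h2 : k < ℓ) : Equiv.Perm (Fin (2 * ℓ + 1)) :=
  Equiv.swap ⟨k - 1, by omega⟩ ⟨k, by omega⟩ *
    Equiv.swap ⟨2 * ℓ - k, by omega⟩ ⟨2 * ℓ - k + 1, by omega⟩

theorem sPerm_val {ℓ k : ℕ} (h1 : 1 ≤ k) (h2 : k < ℓ) (i : Fin (2 * ℓ + 1)) :
    (sPerm h1 h2 i : ℕ) = if (i : ℕ) = k - 1 then k else if (i : ℕ) = k then k - 1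
      else if (i : ℕ) = 2 * ℓ - k then 2 * ℓ - k + 1
      else if (i : ℕ) = 2 * ℓ - k + 1 then 2 * ℓ - k else i := by
  obtain ⟨i, hi⟩ := i
  simp only [sPerm, Equiv.Perm.mul_apply, Equiv.swap_apply_def, Fin.mk.injEq]
  by_cases a1 : i = 2 * ℓ - k
  · simp only [a1, if_true, Fin.mk.injEq]; split_ifs <;> first | rfl | omega
  by_cases a2 : i = 2 * ℓ - k + 1
  · have b1 : ¬ 2 * ℓ - k + 1 = 2 * ℓ - k := by omega
    have b2 : ¬ 2 * ℓ - k = k - 1 := by omega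
    have b3 : ¬ 2 * ℓ - k = k := by omega
    have b4 : ¬ 2 * ℓ - k + 1 = k - 1 := by omega
    have b5 : ¬ 2 * ℓ - k + 1 = k := by omega
    simp only [a2, b1, b2, b3, b4, b5, if_true, if_false, Fin.mk.injEq]
  simp only [a1, a2, if_false, Fin.mk.injEq]; split_ifs <;> rfl

theorem sMat_eq {ℓ k : ℕ} (h1 : 1 ≤ k) (h2 : k < ℓ) :
    sMat ℓ k = (sPerm h1 h2).permMatrix ℂ := by
  ext i j
  have hi := i.2
  have hj := j.2
  simp only [sMat, Matrix.of_apply, Equiv.Perm.permMatrix, Equiv.toPEquiv_apply,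
    PEquiv.toMatrix_apply, Option.mem_some_iff, Fin.ext_iff, sPerm_val,
    Finset.mem_insert, Finset.mem_singleton]
  generalize (i : ℕ) = x at *
  generalize (j : ℕ) = y at *
  by_cases a1 : x = k - 1
  · rw [if_pos a1]; split_ifs <;> first | rfl | (exfalso; omega)
  by_cases a2 : x = k
  · rw [if_neg a1, if_pos a2]; split_ifs <;> first | rfl | (exfalso; omega)
  by_cases a3 : x = 2 * ℓ - k
  · rw [if_neg a1, if_neg a2, if_pos a3]; split_ifs <;> first | rfl | (exfalso; omega)
  by_cases a4 : x = 2 * ℓ - k + 1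
  · rw [if_neg a1, if_neg a2, if_neg a3, if_pos a4]
    split_ifs <;> first | rfl | (exfalso; omega)
  rw [if_neg a1, if_neg a2, if_neg a3, if_neg a4]
  split_ifs <;> first | rfl | (exfalso; omega)

theorem sMat_spec {ℓ k : ℕ} (h1 : 1 ≤ k) (h2 : k < ℓ) :
    (sMat ℓ k).det = 1 ∧ sMat ℓ k * (K ℓ * (sMat ℓ k)ᵀ * K ℓ) = 1 := by
  rw [sMat_eq h1 h2]
  constructor
  · rw [Matrix.det_permutation, sPerm, map_mul, Equiv.Perm.sign_swap, Equiv.Perm.sign_swap]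
    · simp
    · simp [Fin.ext_iff]
    · simp only [ne_eq, Fin.ext_iff]; omega
  · have hc : Fin.revPerm * sPerm h1 h2 = sPerm h1 h2 * Fin.revPerm := by
      ext i
      have hi := i.2
      simp only [Equiv.Perm.mul_apply, Fin.revPerm_apply, Fin.val_rev, sPerm_val]
      split_ifs <;> omega
    have hr : (Fin.revPerm : Equiv.Perm (Fin (2 * ℓ + 1))) * Fin.revPerm = 1 := by
      ext i; simp
    rw [K_eq, Matrix.transpose_permMatrix, ← Matrix.permMatrix_mul, ← Matrix.permMatrix_mul,
      ← Matrix.permMatrix_mul, ← Matrix.permMatrix_one]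
    congr 1
    calc _ = Fin.revPerm * ((sPerm h1 h2)⁻¹ * (Fin.revPerm * sPerm h1 h2)) := by group
      _ = Fin.revPerm * Fin.revPerm := by rw [hc]; group
      _ = 1 := hr

/-- The element `s_k` of `SO_{2ℓ+1}` for `1 ≤ k < ℓ` (other values of `k` are not used). -/
def s (ℓ k : ℕ) : SO ℓ :=
  if h : 1 ≤ k ∧ k < ℓ then
    ⟨⟨sMat ℓ k, (sMat_spec h.1 h.2).1⟩, mem_SO_of (sMat_spec h.1 h.2).1 (sMat_spec h.1 h.2).2⟩
  else 1

theorem tMat_eq {ℓ : ℕ} (h1 : 1 ≤ ℓ) :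
    tMat ℓ = Matrix.diagonal (fun i : Fin (2 * ℓ + 1) => if i = ⟨ℓ, by omega⟩ then (-1 : ℂ) else 1) *
      (Equiv.swap (⟨ℓ - 1, by omega⟩ : Fin (2 * ℓ + 1)) ⟨ℓ + 1, by omega⟩).permMatrix ℂ := by
  ext i j
  obtain ⟨i, hi⟩ := i
  obtain ⟨j, hj⟩ := j
  simp only [tMat, Matrix.of_apply, Matrix.diagonal_mul, Equiv.Perm.permMatrix,
    Equiv.toPEquiv_apply, PEquiv.toMatrix_apply, Option.mem_some_iff, Equiv.swap_apply_def,
    Finset.mem_insert, Finset.mem_singleton, Fin.ext_iff]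
  obtain ⟨l, rfl⟩ : ∃ l, ℓ = l + 1 := ⟨ℓ - 1, by omega⟩
  simp only [Nat.add_sub_cancel]
  by_cases a1 : i = l
  · simp only [a1, if_true, true_or, true_and]
    split_ifs <;> first | (exfalso; omega) | simp
  by_cases a2 : i = l + 1 + 1
  · simp only [a2, if_true]; split_ifs <;> simp_all <;> omega
  simp only [a1, a2, if_false]
  split_ifs <;> (simp_all; try omega)

theorem tMat_spec {ℓ : ℕ} (h1 : 1 ≤ ℓ) :
    (tMat ℓ).det = 1 ∧ tMat ℓ * (K ℓ * (tMat ℓ)ᵀ * K ℓ) = 1 := by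
  rw [tMat_eq h1]
  set D := Matrix.diagonal (fun i : Fin (2 * ℓ + 1) => if i = ⟨ℓ, by omega⟩ then (-1 : ℂ) else 1)
    with hD
  set P := (Equiv.swap (⟨ℓ - 1, by omega⟩ : Fin (2 * ℓ + 1)) ⟨ℓ + 1, by omega⟩).permMatrix ℂ
    with hP
  constructor
  · rw [Matrix.det_mul, hP, Matrix.det_permutation, Equiv.Perm.sign_swap, hD, Matrix.det_diagonal,
      Finset.prod_ite_eq' Finset.univ]
    · simp
    · simp only [ne_eq, Fin.ext_iff]; omega
  · have hDD : D * D = 1 := by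
      rw [hD, Matrix.diagonal_mul_diagonal, ← Matrix.diagonal_one]
      congr 1; ext i; split_ifs <;> simp
    have hKD : K ℓ * D = D * K ℓ := by
      ext i j
      obtain ⟨i, hi⟩ := i
      obtain ⟨j, hj⟩ := j
      simp only [hD, K, Matrix.mul_diagonal, Matrix.diagonal_mul, Matrix.of_apply, Fin.ext_iff]
      split_ifs <;> simp_all <;> omega
    have hPK : P * (K ℓ * P * K ℓ) = 1 := by
      rw [hP, K_eq, ← Matrix.permMatrix_mul, ← Matrix.permMatrix_mul,
        ← Matrix.permMatrix_mul, ← Matrix.permMatrix_one]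
      congr 1
      ext i
      obtain ⟨i, hi⟩ := i
      simp only [Equiv.Perm.mul_apply, Equiv.swap_apply_def, Fin.revPerm_apply, Fin.ext_iff,
        Fin.val_rev, Equiv.Perm.one_apply]
      split_ifs <;> simp_all <;> omega
    have hPt : Pᵀ = P := by rw [hP, Matrix.transpose_permMatrix, Equiv.swap_inv]
    have hDt : Dᵀ = D := by rw [hD, Matrix.diagonal_transpose]
    rw [Matrix.transpose_mul, hPt, hDt]
    calc D * P * (K ℓ * (P * D) * K ℓ) = D * (P * (K ℓ * P * (D * K ℓ))) := by
          simp only [Matrix.mul_assoc]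
      _ = D * (P * (K ℓ * P * K ℓ)) * D := by rw [← hKD]; simp only [Matrix.mul_assoc]
      _ = 1 := by rw [hPK, Matrix.mul_one, hDD]

/-- The element `t_ℓ` of `SO_{2ℓ+1}` for `1 ≤ ℓ` (the value for `ℓ = 0` is not used). -/
def tLast (ℓ : ℕ) : SO ℓ :=
  if h : 1 ≤ ℓ then ⟨⟨tMat ℓ, (tMat_spec h).1⟩, mem_SO_of (tMat_spec h).1 (tMat_spec h).2⟩ else 1

/-- `t_k = s_k s_{k+1} ⋯ s_{ℓ-1} · t_ℓ · s_{ℓ-1} ⋯ s_{k+1} s_k` for `1 ≤ k ≤ ℓ`. -/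
def t (ℓ k : ℕ) : SO ℓ :=
  ((List.range (ℓ - k)).map fun j => s ℓ (k + j)).prod * tLast ℓ *
    (((List.range (ℓ - k)).map fun j => s ℓ (k + j)).reverse).prod

/-- `c = s_{o+1} s_{o+2} ⋯ s_{o+d-1} · t_{o+d}`, the factor of a part `d` with offset `o`. -/
def c (ℓ o d : ℕ) : SO ℓ :=
  ((List.range (d - 1)).map fun j => s ℓ (o + j + 1)).prod * t ℓ (o + d)

/-- For parts `[d₁, d₂, …]` and offset `o`, the product of the factors `c` of the parts in this
order, where the offset of each part is `o` plus the sum of the parts before it. -/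
def nAux (ℓ : ℕ) : ℕ → List ℕ → SO ℓ
  | _, [] => 1
  | o, d :: L => c ℓ o d * nAux ℓ (o + d) L

/-- The element `n = c₁ c₂ ⋯ c_μ` attached to the partition `ℓ₁ ≤ ℓ₂ ≤ ⋯ ≤ ℓ_μ` of `ℓ`. -/
def n {ℓ : ℕ} (p : ℓ.Partition) : SO ℓ :=
  nAux ℓ 0 (p.parts.sort (· ≤ ·))

/-! ### Kac diagrams -/

/-- The exponents `(a₁, …, a_ℓ, 0, -a_ℓ, …, -a₁)`. -/
def expo {ℓ : ℕ} (a : Fin ℓ → ℤ) (i : Fin (2 * ℓ + 1)) : ℤ :=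
  if h : (i : ℕ) < ℓ then a ⟨i, h⟩
  else if h' : ℓ < (i : ℕ) then -a ⟨2 * ℓ - i, by omega⟩
  else 0

theorem expo_rev {ℓ : ℕ} (a : Fin ℓ → ℤ) (i : Fin (2 * ℓ + 1)) : expo a i.rev = -expo a i := by
  obtain ⟨i, hi⟩ := i
  rcases lt_trichotomy i ℓ with h | h | h
  · have h1 : ¬ 2 * ℓ - i < ℓ := by omega
    have h2 : ℓ < 2 * ℓ - i := by omega
    have h3 : 2 * ℓ - (2 * ℓ - i) = i := by omega
    simp [expo, Fin.val_rev, h, h1, h2, h3]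
  · subst h
    have h1 : 2 * i - i = i := by omega
    simp [expo, Fin.val_rev, h1]
  · have h1 : 2 * ℓ - i < ℓ := by omega
    have h2 : ¬ i < ℓ := by omega
    simp [expo, Fin.val_rev, h, h1, h2]

theorem det_coch {ℓ : ℕ} (a : Fin ℓ → ℤ) (z : ℂˣ) :
    (Matrix.diagonal fun i => ((z ^ expo a i : ℂˣ) : ℂ)).det = 1 := by
  have h0 : ∑ i, expo a i = 0 := by
    have h := Equiv.sum_comp (Fin.revPerm : Equiv.Perm (Fin (2 * ℓ + 1))) (expo a)
    simp only [Fin.revPerm_apply, expo_rev, Finset.sum_neg_distrib] at h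
    omega
  have h1 : ∏ i, z ^ expo a i = z ^ ∑ i, expo a i :=
    (map_sum (zmultiplesHom (Additive ℂˣ) (Additive.ofMul z)) (expo a) Finset.univ).symm
  rw [Matrix.det_diagonal, ← Units.coe_prod, h1, h0]
  simp

theorem coch_mul {ℓ : ℕ} (a : Fin ℓ → ℤ) (z : ℂˣ) :
    (Matrix.diagonal fun i => ((z ^ expo a i : ℂˣ) : ℂ)) *
      (K ℓ * (Matrix.diagonal fun i => ((z ^ expo a i : ℂˣ) : ℂ))ᵀ * K ℓ) = 1 := by
  have h : K ℓ * (Matrix.diagonal fun i => ((z ^ expo a i : ℂˣ) : ℂ)) =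
      (Matrix.diagonal fun i => ((z ^ (-expo a i) : ℂˣ) : ℂ)) * K ℓ := by
    ext i j
    simp only [Matrix.mul_diagonal, Matrix.diagonal_mul, K, Matrix.of_apply]
    split_ifs with hij
    · have : j = i.rev := by ext; simp only [Fin.val_rev]; omega
      rw [this, expo_rev]; ring
    · simp
  rw [Matrix.diagonal_transpose, h, Matrix.mul_assoc, K_mul_K, Matrix.mul_one,
    Matrix.diagonal_mul_diagonal, ← Matrix.diagonal_one]
  congr 1
  ext i
  rw [← Units.val_mul, ← _root_.zpow_add]
  simp

/-- The cocharacter group of the torus `A` of diagonal matrices of `SO_{2ℓ+1}` is `ℤ^ℓ`: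
`a = (a₁, …, a_ℓ)` is the cocharacter
`z ↦ Diag(z^{a₁}, …, z^{a_ℓ}, 1, z^{-a_ℓ}, …, z^{-a₁})`. -/
def coch {ℓ : ℕ} (a : Fin ℓ → ℤ) : ℂˣ →* SO ℓ where
  toFun z := ⟨⟨Matrix.diagonal fun i => ((z ^ expo a i : ℂˣ) : ℂ), det_coch a z⟩,
    mem_SO_of (det_coch a z) (coch_mul a z)⟩
  map_one' := by
    ext i j
    simp
  map_mul' z w := by
    apply Subtype.ext
    apply Subtype.ext
    change _ = Matrix.diagonal _ * Matrix.diagonal _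
    rw [Matrix.diagonal_mul_diagonal]
    change Matrix.diagonal _ = _
    exact congrArg _ (funext fun i => by rw [mul_zpow, Units.val_mul])

/-- The simple roots `α_k = e_k - e_{k+1}` for `k < ℓ` and `α_ℓ = e_ℓ`, as vectors of `ℝ^ℓ`;
the pairing with `V = X_*(A) ⊗ ℝ = ℝ^ℓ` is the dot product. -/
def simpleRoot {ℓ : ℕ} (k : Fin ℓ) : Fin ℓ → ℝ :=
  if h : (k : ℕ) + 1 < ℓ then Pi.single k 1 - Pi.single ⟨k + 1, h⟩ 1 else Pi.single k 1

/-- The constants `b_γ = c_γ` on the nodes of the affine diagram: `b₀ = b₁ = 1`, the others `2`. -/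
def b {ℓ : ℕ} (k : Fin (ℓ + 1)) : ℕ := if (k : ℕ) ≤ 1 then 1 else 2

/-- The highest root `α₁ + 2 α₂ + ⋯ + 2 α_ℓ`. -/
def highestRoot (ℓ : ℕ) : Fin ℓ → ℝ := ∑ k : Fin ℓ, (b k.succ : ℝ) • simpleRoot k

/-- The closure of the alcove `C` determined by the simple roots. -/
def closedAlcove (ℓ : ℕ) : Set (Fin ℓ → ℝ) :=
  {x | (∀ k, 0 ≤ simpleRoot k ⬝ᵥ x) ∧ highestRoot ℓ ⬝ᵥ x ≤ 1}

/-- The fundamental coweights `e₁ + ⋯ + e_k`. -/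
def coweight {ℓ : ℕ} (k : Fin ℓ) : Fin ℓ → ℝ := fun i => if i ≤ k then 1 else 0

/-- The vertices of the closed alcove: the origin, and the coweights divided by `b`. -/
noncomputable def vertex {ℓ : ℕ} : Fin (ℓ + 1) → (Fin ℓ → ℝ) :=
  Fin.cases 0 fun k => (1 / (b k.succ : ℝ)) • coweight k

/-- Division of all labels by their greatest common divisor. -/
def reduce {ℓ : ℕ} (r : Fin (ℓ + 1) → ℤ) : Fin (ℓ + 1) → ℤ := fun k => r k / Finset.univ.gcd r

/-- `y` is a Kac diagram of `g ∈ SO_{2ℓ+1}` with respect to the primitive root of unity `ξ` whose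
order is the order `m` of `g`: there are `h` in the group and a cocharacter `a` such that
`h⁻¹ g h = a(ξ)` and `a / m` lies in the closed alcove, and `y` is obtained by removing common
factors from non-negative integers `r_γ` with `a / m = ∑ (r_γ b_γ / m) v_γ` and
`m = ∑ r_γ b_γ`. -/
def IsKacDiagram {ℓ : ℕ} (ξ : ℂˣ) (g : SO ℓ) (y : Fin (ℓ + 1) → ℤ) : Prop :=
  0 < orderOf g ∧ IsPrimitiveRoot ξ (orderOf g) ∧
  ∃ (h : SO ℓ) (a : Fin ℓ → ℤ) (r : Fin (ℓ + 1) → ℤ),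
    h⁻¹ * g * h = coch a ξ ∧
    (fun i => (a i : ℝ) / orderOf g) ∈ closedAlcove ℓ ∧
    (∀ k, 0 ≤ r k) ∧
    (fun i => (a i : ℝ) / orderOf g) =
      ∑ k, ((r k : ℝ) * b k / orderOf g) • vertex k ∧
    (orderOf g : ℤ) = ∑ k, r k * b k ∧
    y = reduce r

/-! ### The labels attached to a partition -/

/-- `m = 2 lcm(ℓ₁, …, ℓ_μ)`. -/
def m {ℓ : ℕ} (p : ℓ.Partition) : ℕ := 2 * p.parts.lcm

/-- The numbers `a m / (2 d)`, for `d` a part and `1 ≤ a ≤ d - 1` (these divisions are exact),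
together with `⌈μ/2⌉` copies of `m / 2` and `⌊μ/2⌋` zeroes. -/
def sigmaMultiset {ℓ : ℕ} (p : ℓ.Partition) : Multiset ℕ :=
  (p.parts.bind fun d => (Finset.Icc 1 (d - 1)).val.map fun a => a * m p / (2 * d)) +
    Multiset.replicate ((p.parts.card + 1) / 2) (m p / 2) +
    Multiset.replicate (p.parts.card / 2) 0

/-- `σ_k` for `1 ≤ k ≤ ℓ`: the `k`-th entry of the list in decreasing order. -/
def sigma {ℓ : ℕ} (p : ℓ.Partition) (k : ℕ) : ℤ :=
  (((sigmaMultiset p).sort (· ≥ ·)).getD (k - 1) 0 : ℕ)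

/-- The labels `m - (σ₁ + σ₂)` on `γ₀`, `σ_k - σ_{k+1}` on `γ_k` for `1 ≤ k < ℓ`, and `σ_ℓ` on
`γ_ℓ`. -/
def labels {ℓ : ℕ} (p : ℓ.Partition) (k : Fin (ℓ + 1)) : ℤ :=
  if (k : ℕ) = 0 then (m p : ℤ) - (sigma p 1 + sigma p 2)
  else if (k : ℕ) < ℓ then sigma p k - sigma p (k + 1)
  else sigma p ℓ

end KacB

/-!
The element `n` is a monomial matrix whose underlying permutation has a cycle of length `2d` for
each part `d` of the partition and one fixed index in the middle, where its entry is `(-1)^μ`.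
Hence `n` is diagonalizable with characteristic polynomial `(X - (-1)^μ) ∏ (X^(2d) - 1)`, and this
is also the characteristic polynomial of the torus element `σ(ξ)`. Similar elements of the special
orthogonal group are conjugate in it: if `P` intertwines them, then so does the orthogonal factor
of the polar decomposition of `P`, the required square root being a polynomial in `P P*`.

Conversely, `-1` is an eigenvalue of `n`, so that a point of the alcove representing a conjugate of
`n` has a coordinate in `1/2 + ℤ`. This forces all its coordinates into `[0, 1/2]`, where they are
determined, up to order, by the numbers `z + z⁻¹` for the eigenvalues `z`; the alcove fixes the
order. The Kac labels of the point are `m` times the values of the affine simple roots.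
-/

namespace KacB

open Matrix Polynomial

variable {ℓ : ℕ}

/-! ### Square roots and isometries -/

section SquareRoot

variable {F : Type*} [Field F] [IsAlgClosed F]

theorem exists_prod_X_sub_C_dvd_sq_sub_X (h2 : (2 : F) ≠ 0) (S : Multiset F)
    (hS : ∀ a ∈ S, a ≠ 0) : ∃ f : F[X], (S.map fun a => X - C a).prod ∣ f ^ 2 - X := by
  induction S using Multiset.induction with
  | empty => exact ⟨0, by simp⟩
  | cons a S ih =>
    obtain ⟨f, r, hr⟩ := ih fun x hx => hS x (Multiset.mem_cons_of_mem hx)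
    set q := (S.map fun a => X - C a).prod
    have eval_hr : f.eval a ^ 2 - a = q.eval a * r.eval a := by
      simpa using congrArg (eval a) hr
    obtain ⟨c, hc⟩ : ∃ c, q.eval a * c ^ 2 + 2 * f.eval a * c + r.eval a = 0 := by
      have hdeg : (C (q.eval a) * X ^ 2 + C (2 * f.eval a) * X + C (r.eval a)).degree ≠ 0 := by
        by_cases hq : q.eval a = 0
        · have hf : f.eval a ≠ 0 := fun hf => hS a (Multiset.mem_cons_self a S) <| by
            simpa [hf, hq] using eval_hr
          rw [hq, C_0, zero_mul, zero_add, degree_linear (mul_ne_zero h2 hf)]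
          exact one_ne_zero
        · rw [degree_quadratic hq]
          exact two_ne_zero
      obtain ⟨c, hc⟩ := IsAlgClosed.exists_root _ hdeg
      exact ⟨c, by simpa [IsRoot] using hc⟩
    obtain ⟨u, hu⟩ : X - C a ∣ q * C c ^ 2 + 2 * f * C c + r := by
      rw [dvd_iff_isRoot, IsRoot]
      simpa using hc
    refine ⟨f + q * C c, u, ?_⟩
    rw [Multiset.map_cons, Multiset.prod_cons]
    linear_combination hr + q * hu

theorem exists_sq_aeval_eq {ι : Type*} [Fintype ι] [DecidableEq ι] (h2 : (2 : F) ≠ 0)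
    {A : Matrix ι ι F} (hA : IsUnit A) : ∃ f : F[X], aeval A f ^ 2 = A := by
  have splits : (A.charpoly.roots.map fun a => X - C a).prod = A.charpoly :=
    ((IsAlgClosed.splits A.charpoly).eq_prod_roots_of_monic A.charpoly_monic).symm
  have hroots : ∀ a ∈ A.charpoly.roots, a ≠ 0 := by
    rintro a ha rfl
    have hdet := ((isUnit_iff_isUnit_det A).1 hA).ne_zero
    rw [det_eq_prod_roots_charpoly] at hdet
    exact hdet (Multiset.prod_eq_zero ha)
  obtain ⟨f, r, hr⟩ := exists_prod_X_sub_C_dvd_sq_sub_X h2 _ hroots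
  rw [splits] at hr
  refine ⟨f, sub_eq_zero.1 ?_⟩
  simpa [aeval_self_charpoly] using congrArg (aeval A) hr

end SquareRoot

section Isometry

variable {F ι : Type*} [Field F] [Fintype ι] [DecidableEq ι]
  {σ : Matrix ι ι F →ₗ[F] Matrix ι ι F}

theorem map_aeval_eq_self_of_map_mul_rev (hone : σ 1 = 1) (hmul : ∀ x y, σ (x * y) = σ y * σ x)
    {q : Matrix ι ι F} (hq : σ q = q) (f : F[X]) : σ (aeval q f) = aeval q f := by
  have hpow : ∀ k, σ (q ^ k) = q ^ k := by
    intro k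
    induction k with
    | zero => rw [pow_zero, hone]
    | succ k ih => rw [pow_succ, hmul, ih, hq, (Commute.self_pow q k).eq]
  simp only [aeval_eq_sum_range, map_sum, map_smul, hpow]

theorem commute_mul_map_of_intertwining (hmul : ∀ x y, σ (x * y) = σ y * σ x)
    {u v p : Matrix ι ι F} (hu : u * σ u = 1) (hv : v * σ v = 1) (hup : u * p = p * v) :
    Commute u (p * σ p) := by
  have h : u * (p * σ p) * σ u = p * σ p := by
    calc u * (p * σ p) * σ u = (u * p) * σ (u * p) := by simp only [hmul, mul_assoc]
      _ = p * (v * σ v) * σ p := by simp only [hup, hmul, mul_assoc]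
      _ = p * σ p := by rw [hv, mul_one]
  calc u * (p * σ p) = u * (p * σ p) * (σ u * u) := by rw [mul_eq_one_comm.1 hu, mul_one]
    _ = p * σ p * u := by rw [← mul_assoc, h]

/-- The idea is a polar decomposition: `p = s * w` with `s ^ 2 = p * σ p`. -/
theorem exists_isometry_intertwining [IsAlgClosed F] (h2 : (2 : F) ≠ 0)
    (hone : σ 1 = 1) (hmul : ∀ x y, σ (x * y) = σ y * σ x) (hinv : ∀ x, σ (σ x) = x)
    {u v p : Matrix ι ι F} (hu : u * σ u = 1) (hv : v * σ v = 1) (hp : IsUnit p)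
    (hup : u * p = p * v) : ∃ w, w * σ w = 1 ∧ u * w = w * v := by
  have hσp : IsUnit (σ p) := by
    obtain ⟨r, hr⟩ := hp.exists_left_inv
    exact .of_mul_eq_one (σ r) (by rw [← hmul, hr, hone])
  obtain ⟨f, hf⟩ := exists_sq_aeval_eq h2 (hp.mul hσp)
  obtain ⟨s, hs⟩ : IsUnit (aeval (p * σ p) f) :=
    (isUnit_pow_iff two_ne_zero).1 (hf.symm ▸ hp.mul hσp)
  have hus : Commute u s := hs ▸ Algebra.commute_of_mem_adjoin_singleton_of_commute
    (aeval_mem_adjoin_singleton F _) (commute_mul_map_of_intertwining hmul hu hv hup)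
  have hσs : σ s = s :=
    hs ▸ map_aeval_eq_self_of_map_mul_rev hone hmul (by rw [hmul, hinv]) f
  have hσs_inv : σ (s⁻¹ : (Matrix ι ι F)ˣ) = (s⁻¹ : (Matrix ι ι F)ˣ) :=
    s.eq_inv_of_mul_eq_one_right (by rw [← hσs, ← hmul, s.mul_inv, hone])
  rw [← hs] at hf
  refine ⟨(s⁻¹ : (Matrix ι ι F)ˣ) * p, ?_, ?_⟩
  · calc (s⁻¹ : (Matrix ι ι F)ˣ) * p * σ ((s⁻¹ : (Matrix ι ι F)ˣ) * p)
        = (s⁻¹ : (Matrix ι ι F)ˣ) * (p * σ p) * (s⁻¹ : (Matrix ι ι F)ˣ) := by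
          simp only [hmul, hσs_inv, mul_assoc]
      _ = 1 := by rw [← hf, sq, Units.inv_mul_cancel_left, Units.mul_inv]
  · rw [← mul_assoc, (hus.units_inv_right).eq, mul_assoc, hup, mul_assoc]

end Isometry

/-! ### Conjugacy in the special orthogonal group -/

/-- The inclusion of `SO_{2ℓ+1}` into the monoid of all matrices. -/
def toMat : SO ℓ →* Mat ℓ := Matrix.SpecialLinearGroup.coeMonoidHom.comp (SO ℓ).subtype

theorem toMat_injective : Function.Injective (toMat : SO ℓ → Mat ℓ) :=
  Subtype.val_injective.comp Subtype.val_injective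

theorem toMat_coch (a : Fin ℓ → ℤ) (z : ℂˣ) :
    toMat (coch a z) = diagonal fun i => ((z ^ expo a i : ℂˣ) : ℂ) := rfl

/-- The adjoint of a matrix with respect to the symmetric bilinear form with Gram matrix `K`;
`SO_{2ℓ+1}` consists of the isometries of this form of determinant one. -/
def adj : Mat ℓ →ₗ[ℂ] Mat ℓ where
  toFun M := K ℓ * Mᵀ * K ℓ
  map_add' M N := by rw [transpose_add, mul_add, add_mul]
  map_smul' z M := by simp

theorem adj_apply (M : Mat ℓ) : adj M = K ℓ * Mᵀ * K ℓ := rfl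

theorem adj_one : adj (1 : Mat ℓ) = 1 := by
  rw [adj_apply, transpose_one, mul_one, K_mul_K]

theorem adj_mul (M N : Mat ℓ) : adj (M * N) = adj N * adj M := by
  calc K ℓ * (M * N)ᵀ * K ℓ = K ℓ * Nᵀ * 1 * Mᵀ * K ℓ := by
        simp only [transpose_mul, mul_assoc, one_mul]
    _ = K ℓ * Nᵀ * K ℓ * (K ℓ * Mᵀ * K ℓ) := by simp only [← K_mul_K, mul_assoc]

theorem adj_adj (M : Mat ℓ) : adj (adj M) = M := by
  calc K ℓ * (K ℓ * Mᵀ * K ℓ)ᵀ * K ℓ = (K ℓ * K ℓ) * M * (K ℓ * K ℓ) := by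
        simp only [transpose_mul, transpose_transpose, K_transpose, mul_assoc]
    _ = M := by rw [K_mul_K, one_mul, mul_one]

theorem det_adj (M : Mat ℓ) : (adj M).det = M.det := by
  have h : (K ℓ).det * (K ℓ).det = 1 := by rw [← det_mul, K_mul_K, det_one]
  rw [adj_apply, det_mul, det_mul, det_transpose]
  linear_combination M.det * h

theorem toMat_mul_adj (g : SO ℓ) : toMat g * adj (toMat g) = 1 := by
  have h : toMat g = (K ℓ * toMat g⁻¹ * K ℓ)ᵀ := g.2
  have h' : adj (toMat g) = toMat g⁻¹ := by
    conv_lhs => rw [h]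
    simpa only [adj_apply, transpose_mul, transpose_transpose, K_transpose, mul_assoc] using
      adj_adj (toMat g⁻¹)
  rw [h', ← map_mul, mul_inv_cancel, map_one]

theorem exists_toMat_eq {M : Mat ℓ} (hdet : M.det = 1) (hM : M * adj M = 1) :
    ∃ g : SO ℓ, toMat g = M :=
  ⟨⟨⟨M, hdet⟩, mem_SO_of hdet hM⟩, rfl⟩

theorem exists_conj_of_toMat_mul_eq {g d : SO ℓ} {P : Mat ℓ} (hP : IsUnit P)
    (hgP : toMat g * P = P * toMat d) : ∃ h : SO ℓ, h⁻¹ * g * h = d := by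
  obtain ⟨w, hw, hgw⟩ := exists_isometry_intertwining two_ne_zero adj_one adj_mul adj_adj
    (toMat_mul_adj g) (toMat_mul_adj d) hP hgP
  have hdet : w.det * w.det = 1 := by
    simpa only [det_mul, det_adj, det_one] using congrArg det hw
  -- the size is odd, so that scaling by the sign `w.det` makes the determinant equal to one
  obtain ⟨h, hh⟩ : ∃ h : SO ℓ, toMat h = w.det • w := by
    refine exists_toMat_eq ?_ ?_
    · rw [det_smul, Fintype.card_fin, pow_succ, pow_mul, pow_two, hdet, one_pow, one_mul, hdet]
    · rw [map_smul, smul_mul_smul_comm, hw, hdet, one_smul]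
  refine ⟨h, ?_⟩
  rw [mul_assoc, inv_mul_eq_iff_eq_mul]
  apply toMat_injective
  rw [map_mul, map_mul, hh, mul_smul_comm, smul_mul_assoc, hgw]

/-! ### The permutation underlying `n` -/

/-- The `x`-th index (counted from zero) if `b` is true, and its mirror image otherwise. -/
def mirrorIndex (ℓ : ℕ) : ℕ × Bool → ℕ
  | (x, true) => x
  | (x, false) => 2 * ℓ - x

theorem mirrorIndex_lt {x : ℕ} (hx : x < ℓ) (b : Bool) : mirrorIndex ℓ (x, b) < 2 * ℓ + 1 := by
  cases b <;> simp only [mirrorIndex] <;> omega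

/-- Row `i` of `M` (counted from zero) has the entry `z` in column `j` and zeroes elsewhere. -/
def HasRow (M : Mat ℓ) (i j : ℕ) (z : ℂ) : Prop :=
  ∀ a b : Fin (2 * ℓ + 1), (a : ℕ) = i → M a b = if (b : ℕ) = j then z else 0

theorem HasRow.one (i : ℕ) : HasRow (1 : Mat ℓ) i i 1 := by
  rintro a b rfl
  simp only [one_apply, Fin.ext_iff, eq_comm]

theorem HasRow.mul {M N : Mat ℓ} {i j k : ℕ} {z w : ℂ} (hM : HasRow M i j z)
    (hN : HasRow N j k w) (hj : j < 2 * ℓ + 1) : HasRow (M * N) i k (z * w) := by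
  intro a b ha
  rw [mul_apply, Finset.sum_eq_single ⟨j, hj⟩]
  · rw [hM a _ ha, if_pos rfl, hN _ b rfl, mul_ite, mul_zero]
  · intro c _ hc
    rw [hM a c ha, if_neg (fun h => hc (Fin.ext h)), zero_mul]
  · simp

theorem HasRow.diagonal (w : Fin (2 * ℓ + 1) → ℂ) (i : Fin (2 * ℓ + 1)) :
    HasRow (diagonal w) i i (w i) := by
  intro a b ha
  rw [Fin.ext ha, diagonal_apply]
  simp only [Fin.ext_iff, eq_comm]

theorem HasRow.permMatrix (π : Equiv.Perm (Fin (2 * ℓ + 1))) (i : Fin (2 * ℓ + 1)) :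
    HasRow (π.permMatrix ℂ) i (π i) 1 := by
  intro a b ha
  rw [Fin.ext ha, Equiv.Perm.permMatrix, PEquiv.toMatrix_toPEquiv_apply,
    Pi.single_apply]
  simp only [Fin.ext_iff]

/-- Right multiplication by `g` moves the coordinates other than the middle one according to `f`,
where coordinates are named as in `mirrorIndex`, and multiplies the middle one by `ε`. -/
structure ActsBy (g : SO ℓ) (f : ℕ × Bool → ℕ × Bool) (ε : ℂ) : Prop where
  map_lt : ∀ x b, x < ℓ → (f (x, b)).1 < ℓ
  hasRow : ∀ x b, x < ℓ → HasRow (toMat g) (mirrorIndex ℓ (x, b)) (mirrorIndex ℓ (f (x, b))) 1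
  hasRow_middle : HasRow (toMat g) ℓ ℓ ε

namespace ActsBy

variable {g h : SO ℓ} {f f' : ℕ × Bool → ℕ × Bool} {ε ε' : ℂ}

protected theorem one : ActsBy (1 : SO ℓ) id 1 where
  map_lt _ _ hx := hx
  hasRow x b _ := by simpa only [map_one, id] using HasRow.one _
  hasRow_middle := by simpa only [map_one] using HasRow.one _

protected theorem mul (hg : ActsBy g f ε) (hh : ActsBy h f' ε') :
    ActsBy (g * h) (f' ∘ f) (ε * ε') where
  map_lt x b hx := hh.map_lt _ _ (hg.map_lt x b hx)
  hasRow x b hx := by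
    have hfx := hg.map_lt x b hx
    simpa only [map_mul, mul_one, Function.comp_def] using
      (hg.hasRow x b hx).mul (hh.hasRow _ _ hfx) (mirrorIndex_lt hfx _)
  hasRow_middle := by
    simpa only [map_mul] using hg.hasRow_middle.mul hh.hasRow_middle (by omega)

theorem congr (hg : ActsBy g f ε) (hf : ∀ x b, x < ℓ → f (x, b) = f' (x, b)) :
    ActsBy g f' ε where
  map_lt x b hx := hf x b hx ▸ hg.map_lt x b hx
  hasRow x b hx := hf x b hx ▸ hg.hasRow x b hx
  hasRow_middle := hg.hasRow_middle

end ActsBy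

theorem toMat_s {k : ℕ} (hk : k + 1 < ℓ) : toMat (s ℓ (k + 1)) = sMat ℓ (k + 1) := by
  rw [s, dif_pos ⟨k.succ_pos, hk⟩]; rfl

theorem toMat_tLast : toMat (tLast (ℓ + 1)) = tMat (ℓ + 1) := by
  rw [tLast, dif_pos (Nat.le_add_left 1 ℓ)]; rfl

theorem actsBy_s {k : ℕ} (hk : k + 1 < ℓ) :
    ActsBy (s ℓ (k + 1)) (fun x => (Equiv.swap k (k + 1) x.1, x.2)) 1 := by
  have hasRow {i j : ℕ} (hi : i < 2 * ℓ + 1) (hj : (sPerm k.succ_pos hk ⟨i, hi⟩ : ℕ) = j) :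
      HasRow (toMat (s ℓ (k + 1))) i j 1 := by
    rw [toMat_s hk, sMat_eq k.succ_pos hk, ← hj]
    exact HasRow.permMatrix _ ⟨i, hi⟩
  refine ⟨fun x b hx => ?_, fun x b hx => hasRow (mirrorIndex_lt hx b) ?_,
    hasRow (by omega) ?_⟩
  · simp only [Equiv.swap_apply_def]
    split_ifs <;> omega
  · rw [sPerm_val]
    cases b <;> simp only [mirrorIndex, Equiv.swap_apply_def] <;> grind
  · grind [sPerm_val]

/-- Exchange of the `k`-th index with its mirror image. -/
def flipAt (k : ℕ) (x : ℕ × Bool) : ℕ × Bool := (x.1, if x.1 = k then !x.2 else x.2)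

theorem actsBy_tLast : ActsBy (tLast (ℓ + 1)) (flipAt ℓ) (-1) := by
  have hasRow {i j : ℕ} {z : ℂ} (hi : i < 2 * (ℓ + 1) + 1)
      (hj : (if i = ℓ then ℓ + 2 else if i = ℓ + 2 then ℓ else i) = j)
      (hz : (if i = ℓ + 1 then -1 else 1) = z) : HasRow (toMat (tLast (ℓ + 1))) i j z := by
    rw [toMat_tLast, tMat_eq ℓ.succ_pos, ← hj, ← hz]
    convert (HasRow.diagonal _ ⟨i, hi⟩).mul (HasRow.permMatrix _ ⟨i, hi⟩) hi using 1
    · simp only [Equiv.swap_apply_def, Fin.mk.injEq, Nat.succ_eq_add_one, Nat.add_sub_cancel]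
      split_ifs <;> rfl
    · simp only [Fin.mk.injEq, mul_one]
  refine ⟨fun _ _ hx => hx, fun x b hx => hasRow (mirrorIndex_lt hx b) ?_ ?_,
    hasRow (by omega) (by grind) (if_pos rfl)⟩
  · cases b <;> by_cases hxl : x = ℓ <;> simp [mirrorIndex, flipAt, hxl] <;> grind
  · rw [if_neg]
    cases b <;> simp only [mirrorIndex] <;> omega

theorem t_self : t ℓ ℓ = tLast ℓ := by simp [t]

theorem t_eq_conj {k : ℕ} (hk : k < ℓ) : t ℓ k = s ℓ k * t ℓ (k + 1) * s ℓ k := by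
  obtain ⟨e, rfl⟩ := Nat.exists_eq_add_of_lt hk
  have hrange : (List.range (k + e + 1 - k)).map (fun j => s (k + e + 1) (k + j)) =
      s (k + e + 1) k :: (List.range (k + e + 1 - (k + 1))).map
        (fun j => s (k + e + 1) (k + 1 + j)) := by
    rw [show k + e + 1 - k = e + 1 by omega, show k + e + 1 - (k + 1) = e by omega,
      List.range_succ_eq_map, List.map_cons, List.map_map]
    simp only [Function.comp_def, Nat.succ_eq_add_one, add_zero, add_assoc, add_comm 1]
  simp only [t, hrange, List.prod_cons, List.reverse_cons, List.prod_append, List.prod_nil,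
    mul_assoc, mul_one]

theorem actsBy_t {k : ℕ} (hk : k + 1 ≤ ℓ) : ActsBy (t ℓ (k + 1)) (flipAt k) (-1) := by
  obtain ⟨e, rfl⟩ := Nat.exists_eq_add_of_le hk
  induction e generalizing k with
  | zero => rw [add_zero, t_self]; exact actsBy_tLast
  | succ e ih =>
    have hlt : k + 1 < k + 1 + (e + 1) := by omega
    have ht : ActsBy (t (k + 1 + (e + 1)) (k + 1 + 1)) (flipAt (k + 1)) (-1) := by
      rw [show k + 1 + (e + 1) = k + 1 + 1 + e by omega]
      exact ih (by omega)
    rw [t_eq_conj hlt, ← one_mul (-1 : ℂ), ← mul_one (1 * -1 : ℂ)]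
    refine (((actsBy_s hlt).mul ht).mul (actsBy_s hlt)).congr fun x b _ => ?_
    simp only [Function.comp_apply, flipAt, Equiv.swap_apply_self]
    grind

theorem actsBy_prod_s {o e : ℕ} (h : o + e < ℓ) :
    ActsBy ((List.range e).map fun j => s ℓ (o + j + 1)).prod
      (fun x => (if x.1 = o then o + e else if o < x.1 ∧ x.1 ≤ o + e then x.1 - 1 else x.1, x.2))
      1 := by
  induction e with
  | zero => exact ActsBy.one.congr fun x b _ => by grind
  | succ e ih =>
    rw [List.range_succ, List.map_append, List.prod_append, List.map_singleton,
      List.prod_singleton, ← one_mul (1 : ℂ)]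
    refine ((ih (by omega)).mul (actsBy_s h)).congr fun x b _ => ?_
    grind

/-- The cyclic permutation of the interval `[o, o + d)` and its mirror image behind the factor `c`,
as a cycle of length `2 * d`. -/
def cMap (o d : ℕ) (x : ℕ × Bool) : ℕ × Bool :=
  if x.1 = o then (o + d - 1, !x.2) else if o < x.1 ∧ x.1 < o + d then (x.1 - 1, x.2) else x

theorem actsBy_c {o d : ℕ} (hd : 1 ≤ d) (h : o + d ≤ ℓ) : ActsBy (c ℓ o d) (cMap o d) (-1) := by
  obtain ⟨d, rfl⟩ := Nat.exists_eq_add_of_le' hd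
  rw [c, ← add_assoc, ← one_mul (-1 : ℂ)]
  refine ((actsBy_prod_s (by omega)).mul (actsBy_t (by omega))).congr fun x b _ => ?_
  grind [cMap, flipAt]

/-- The permutation behind `nAux`. -/
def nMap : ℕ → List ℕ → ℕ × Bool → ℕ × Bool
  | _, [] => id
  | o, d :: L => nMap (o + d) L ∘ cMap o d

theorem actsBy_nAux {o : ℕ} {L : List ℕ} (hL : ∀ d ∈ L, 1 ≤ d) (h : o + L.sum ≤ ℓ) :
    ActsBy (nAux ℓ o L) (nMap o L) ((-1) ^ L.length) := by
  induction L generalizing o with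
  | nil => exact ActsBy.one
  | cons d L ih =>
    rw [List.sum_cons, ← add_assoc] at h
    rw [List.length_cons, pow_succ']
    exact (actsBy_c (hL d List.mem_cons_self) (by omega)).mul
      (ih (fun e he => hL e (List.mem_cons_of_mem _ he)) h)

theorem nMap_append (o : ℕ) (L₁ L₂ : List ℕ) :
    nMap o (L₁ ++ L₂) = nMap (o + L₁.sum) L₂ ∘ nMap o L₁ := by
  induction L₁ generalizing o with
  | nil => rfl
  | cons d L₁ ih =>
    rw [List.cons_append, nMap, ih, nMap, List.sum_cons, ← add_assoc, Function.comp_assoc]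

theorem nMap_of_lt {o : ℕ} (L : List ℕ) {x : ℕ} (hx : x < o) (b : Bool) :
    nMap o L (x, b) = (x, b) := by
  induction L generalizing o with
  | nil => rfl
  | cons d L ih =>
    rw [nMap, Function.comp_apply, cMap, if_neg hx.ne, if_neg (fun h => hx.not_gt h.1),
      ih (hx.trans_le (Nat.le_add_right o d))]

theorem nMap_of_ge {o : ℕ} {L : List ℕ} (hL : ∀ d ∈ L, 1 ≤ d) {x : ℕ} (hx : o + L.sum ≤ x)
    (b : Bool) : nMap o L (x, b) = (x, b) := by
  induction L generalizing o with
  | nil => rfl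
  | cons d L ih =>
    have hd := hL d List.mem_cons_self
    rw [List.sum_cons, ← add_assoc] at hx
    rw [nMap, Function.comp_apply, cMap, if_neg (by dsimp only; omega),
      if_neg (by dsimp only; omega), ih (fun e he => hL e (List.mem_cons_of_mem _ he)) hx]

theorem nMap_eq_cMap {o d : ℕ} {L₁ L₂ : List ℕ} (hL₁ : ∀ e ∈ L₁, 1 ≤ e) {x : ℕ}
    (hx : o + L₁.sum ≤ x) (hx' : x < o + L₁.sum + d) (b : Bool) :
    nMap o (L₁ ++ d :: L₂) (x, b) = cMap (o + L₁.sum) d (x, b) := by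
  rw [nMap_append, Function.comp_apply, nMap_of_ge hL₁ hx, nMap, Function.comp_apply]
  have hlt : (cMap (o + L₁.sum) d (x, b)).1 < o + L₁.sum + d := by
    simp only [cMap]
    split_ifs <;> omega
  exact nMap_of_lt L₂ hlt _

/-! ### Diagonalization of `n` -/

section CyclicRows

variable {F : Type*} [Field F]

/-- The matrix of a cycle of length `k` all of whose entries are `c`. -/
def weightedCycle (k : ℕ) [NeZero k] (c : F) : Matrix (Fin k) (Fin k) F :=
  of fun i => Pi.single (i + 1) c

/-- The matrix of the discrete Fourier transform. -/
def fourierMatrix (k : ℕ) (ζ : F) : Matrix (Fin k) (Fin k) F :=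
  (vandermonde fun a : Fin k => ζ ^ (a : ℕ))ᵀ

theorem isUnit_fourierMatrix {k : ℕ} {ζ : F} (hζ : IsPrimitiveRoot ζ k) :
    IsUnit (fourierMatrix k ζ) := by
  rw [isUnit_iff_isUnit_det, fourierMatrix, det_transpose, isUnit_iff_ne_zero,
    det_vandermonde_ne_zero_iff]
  exact fun a b hab => Fin.ext (hζ.pow_inj a.2 b.2 hab)

theorem weightedCycle_mul_fourierMatrix {k : ℕ} [NeZero k] (c : F) {ζ : F} (hζ : ζ ^ k = 1) :
    weightedCycle k c * fourierMatrix k ζ =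
      fourierMatrix k ζ * diagonal fun a : Fin k => ζ ^ (a : ℕ) * c := by
  ext j a
  rw [mul_diagonal, mul_apply]
  simp only [weightedCycle, fourierMatrix, of_apply, transpose_apply, vandermonde_apply,
    Pi.single_apply, ite_mul, zero_mul, Finset.sum_ite_eq', Finset.mem_univ, if_true]
  have hwrap : (ζ ^ (a : ℕ)) ^ ((j + 1 : Fin k) : ℕ) = (ζ ^ (a : ℕ)) ^ ((j : ℕ) + 1) := by
    rw [Fin.val_add, Fin.val_one', Nat.add_mod_mod, ← pow_eq_pow_mod]
    rw [pow_right_comm, hζ, one_pow]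
  rw [hwrap]
  ring

variable {κ ι : Type*} [Fintype κ] [Fintype ι] [DecidableEq ι]

theorem exists_diagonalization_of_cyclic_rows {k : κ → ℕ} [∀ ν, NeZero (k ν)] {c ζ : κ → F}
    (hζ : ∀ ν, IsPrimitiveRoot (ζ ν) (k ν)) (e : (Σ ν, Fin (k ν)) ≃ ι) {M : Matrix ι ι F}
    (hM : ∀ ν j, M.row (e ⟨ν, j⟩) = Pi.single (e ⟨ν, j + 1⟩) (c ν)) :
    ∃ (P : Matrix ι ι F) (w : ι → F), IsUnit P ∧ M * P = P * diagonal w ∧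
      ∏ i, (X - C (w i)) = ∏ ν, (X ^ k ν - C (c ν ^ k ν)) := by
  classical
  let W := blockDiagonal' fun ν => weightedCycle (k ν) (c ν)
  let V := blockDiagonal' fun ν => fourierMatrix (k ν) (ζ ν)
  let w : (Σ ν, Fin (k ν)) → F := fun u => ζ u.1 ^ (u.2 : ℕ) * c u.1
  have hMW : M = reindexAlgEquiv F F e W := by
    ext a b
    obtain ⟨⟨ν, j⟩, rfl⟩ := e.surjective a
    obtain ⟨⟨ν', j'⟩, rfl⟩ := e.surjective b
    refine (congrFun (hM ν j) _).trans ?_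
    obtain rfl | hν := eq_or_ne ν ν'
    · simp [W, weightedCycle, Pi.single_apply]
    · simp [W, hν.symm, blockDiagonal'_apply_ne _ _ _ hν]
  have hWV : W * V = V * diagonal w := by
    rw [← blockDiagonal'_diagonal fun ν (a : Fin (k ν)) => ζ ν ^ (a : ℕ) * c ν,
      ← blockDiagonal'_mul, ← blockDiagonal'_mul]
    exact congrArg _ (funext fun ν => weightedCycle_mul_fourierMatrix _ (hζ ν).pow_eq_one)
  have hV : IsUnit V :=
    (Pi.isUnit_iff.2 fun ν => isUnit_fourierMatrix (hζ ν)).map (blockDiagonal'RingHom _ F)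
  refine ⟨reindexAlgEquiv F F e V, w ∘ e.symm, hV.map _, ?_, ?_⟩
  · rw [hMW, ← map_mul, hWV, map_mul]
    congr 1
    simp
  · have hprod : ∀ ν, ∏ j : Fin (k ν), (X - C (ζ ν ^ (j : ℕ) * c ν)) =
        X ^ k ν - C (c ν ^ k ν) := fun ν => by
      rw [_root_.X_pow_sub_C_eq_prod (hζ ν) (NeZero.pos _) rfl,
        Fin.prod_univ_eq_prod_range fun j => X - C (ζ ν ^ j * c ν)]
    rw [← Finset.prod_congr rfl fun ν _ => hprod ν, ← Fintype.prod_sigma',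
      ← e.symm.prod_comp]
    rfl

end CyclicRows

/-- The `j`-th point of the cycle of length `2 * d` of `cMap o d`. -/
def cyclePoint (o d j : ℕ) : ℕ × Bool :=
  if j < d then (o + d - 1 - j, true) else (o + 2 * d - 1 - j, false)

theorem cyclePoint_fst_mem {o d j : ℕ} (hj : j < 2 * d) :
    o ≤ (cyclePoint o d j).1 ∧ (cyclePoint o d j).1 < o + d := by
  grind [cyclePoint]

theorem cMap_cyclePoint {o d : ℕ} [NeZero (2 * d)] (j : Fin (2 * d)) :
    cMap o d (cyclePoint o d j) = cyclePoint o d (j + 1 : Fin (2 * d)) := by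
  have hj := j.2
  have hstep : ((j + 1 : Fin (2 * d)) : ℕ) = if (j : ℕ) + 1 = 2 * d then 0 else (j : ℕ) + 1 := by
    rw [Fin.val_add, Fin.val_one', Nat.add_mod_mod]
    split_ifs with h
    · rw [h, Nat.mod_self]
    · exact Nat.mod_eq_of_lt (by omega)
  grind [cyclePoint, cMap]

theorem cyclePoint_injective {o d : ℕ} :
    Function.Injective fun j : Fin (2 * d) => cyclePoint o d j := by
  intro i j hij
  grind [cyclePoint]

theorem mirrorIndex_injOn : {x : ℕ × Bool | x.1 < ℓ}.InjOn (mirrorIndex ℓ) := by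
  rintro ⟨x, _ | _⟩ hx ⟨y, _ | _⟩ hy h <;> grind [mirrorIndex]

theorem mirrorIndex_ne {x : ℕ × Bool} (hx : x.1 < ℓ) : mirrorIndex ℓ x ≠ ℓ := by
  obtain ⟨x, _ | _⟩ := x <;> grind [mirrorIndex]

/-- The lengths of the cycles of `nAux`: one fixed index in the middle, and a cycle of length
`2 * d` for each part `d`. -/
def cycleLength (L : List ℕ) : Option (Fin L.length) → ℕ
  | none => 1
  | some ν => 2 * L[ν]

theorem sum_take_add_getElem_le {L : List ℕ} {i k : ℕ} (hi : i < L.length) (hik : i < k) :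
    (L.take i).sum + L[i] ≤ (L.take k).sum := by
  rw [← List.sum_take_succ L i hi]
  exact (List.take_sublist_take_left hik).sum_le_sum fun _ _ => Nat.zero_le _

theorem card_sigma_cycleLength (L : List ℕ) :
    Fintype.card (Σ ν, Fin (cycleLength L ν)) = 2 * L.sum + 1 := by
  simp only [Fintype.card_sigma, Fintype.card_fin]
  simp only [Fintype.sum_option, cycleLength, Fin.getElem_fin, ← Finset.mul_sum,
    Fin.sum_univ_getElem, add_comm]

/-- The `j`-th index of a cycle of `nAux`. -/
def cycleIndex (L : List ℕ) : (Σ ν, Fin (cycleLength L ν)) → ℕ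
  | ⟨none, _⟩ => L.sum
  | ⟨some ν, j⟩ => mirrorIndex L.sum (cyclePoint (L.take ν).sum L[ν] j)

theorem cyclePoint_fst_lt_sum {L : List ℕ} (ν : Fin L.length) (j : Fin (2 * L[ν])) :
    (cyclePoint (L.take ν).sum L[ν] j).1 < L.sum := by
  have hle := sum_take_add_getElem_le ν.2 ν.2
  rw [List.take_length] at hle
  exact (cyclePoint_fst_mem j.2).2.trans_le hle

theorem cycleIndex_lt {L : List ℕ} (u : Σ ν, Fin (cycleLength L ν)) :
    cycleIndex L u < 2 * L.sum + 1 := by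
  obtain ⟨_ | ν, j⟩ := u
  · simp only [cycleIndex]
    omega
  · exact mirrorIndex_lt (cyclePoint_fst_lt_sum ν j) _

theorem cycleIndex_injective (L : List ℕ) : Function.Injective (cycleIndex L) := by
  rintro ⟨_ | ν, j⟩ ⟨_ | ν', j'⟩ h
  · exact congrArg _ (Subsingleton.elim (α := Fin 1) j j')
  · exact absurd h.symm (mirrorIndex_ne (cyclePoint_fst_lt_sum ν' j'))
  · exact absurd h (mirrorIndex_ne (cyclePoint_fst_lt_sum ν j))
  · have hpoint := mirrorIndex_injOn (cyclePoint_fst_lt_sum ν j) (cyclePoint_fst_lt_sum ν' j') h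
    have hmem := cyclePoint_fst_mem (o := (L.take ν).sum) j.2
    have hmem' := cyclePoint_fst_mem (o := (L.take ν').sum) j'.2
    have hfst := congrArg Prod.fst hpoint
    obtain rfl : ν = ν' := by
      rcases lt_trichotomy ν ν' with hlt | heq | hlt
      · have hle := sum_take_add_getElem_le ν.2 (Fin.lt_def.1 hlt)
        simp only [Fin.getElem_fin] at *
        omega
      · exact heq
      · have hle := sum_take_add_getElem_le ν'.2 (Fin.lt_def.1 hlt)
        simp only [Fin.getElem_fin] at *
        omega
    exact congrArg _ (cyclePoint_injective hpoint)

theorem bijective_cycleIndex (L : List ℕ) :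
    Function.Bijective fun u => (⟨cycleIndex L u, cycleIndex_lt u⟩ : Fin (2 * L.sum + 1)) := by
  rw [Fintype.bijective_iff_injective_and_card, card_sigma_cycleLength, Fintype.card_fin]
  exact ⟨fun u v h => cycleIndex_injective L (Fin.mk.inj h), rfl⟩

theorem HasRow.row_eq {M : Mat ℓ} {i j : Fin (2 * ℓ + 1)} {z : ℂ} (h : HasRow M i j z) :
    M.row i = Pi.single j z := by
  ext a
  rw [Pi.single_apply, row_apply, h i a rfl]
  simp only [Fin.ext_iff]

theorem hasRow_nAux_some {L : List ℕ} (hL : ∀ d ∈ L, 1 ≤ d) (ν : Fin L.length)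
    [NeZero (2 * L[ν])] (j : Fin (2 * L[ν])) :
    HasRow (toMat (nAux L.sum 0 L)) (cycleIndex L ⟨some ν, j⟩)
      (cycleIndex L ⟨some ν, (j + 1 : Fin (2 * L[ν]))⟩) 1 := by
  have hmem := cyclePoint_fst_mem (o := (L.take ν).sum) j.2
  have hmap : nMap 0 L (cyclePoint (L.take ν).sum L[ν] j) =
      cyclePoint (L.take ν).sum L[ν] (j + 1 : Fin (2 * L[ν])) := by
    have hcMap := nMap_eq_cMap (o := 0) (L₂ := L.drop (ν + 1))
      (fun e he => hL e (List.mem_of_mem_take he)) (by simpa using hmem.1) (by simpa using hmem.2)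
      (cyclePoint (L.take ν).sum L[ν] j).2
    rw [← cMap_cyclePoint]
    simpa using hcMap
  have hrow := (actsBy_nAux hL (zero_add L.sum).le).hasRow _
    (cyclePoint (L.take ν).sum L[ν] j).2 (cyclePoint_fst_lt_sum ν j)
  rwa [Prod.mk.eta, hmap] at hrow

theorem exists_diagonalization_nAux {L : List ℕ} (hL : ∀ d ∈ L, 1 ≤ d) (hsum : L.sum = ℓ) :
    ∃ (P : Mat ℓ) (w : Fin (2 * ℓ + 1) → ℂ), IsUnit P ∧
      toMat (nAux ℓ 0 L) * P = P * diagonal w ∧ ∏ i, (X - C (w i)) =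
        (X - C ((-1) ^ L.length)) * (L.map fun d => (X ^ (2 * d) - 1 : ℂ[X])).prod := by
  subst hsum
  have hlength : ∀ ν, NeZero (cycleLength L ν)
    | none => ⟨one_ne_zero⟩
    | some ν => ⟨mul_ne_zero two_ne_zero (Nat.one_le_iff_ne_zero.1 (hL _ (List.getElem_mem ν.2)))⟩
  let e := Equiv.ofBijective _ (bijective_cycleIndex L)
  let c (ν : Option (Fin L.length)) : ℂ := ν.elim ((-1) ^ L.length) fun _ => 1
  have hrow : ∀ ν j, (toMat (nAux L.sum 0 L)).row (e ⟨ν, j⟩) = Pi.single (e ⟨ν, j + 1⟩) (c ν) := by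
    rintro (_ | ν) j
    · exact HasRow.row_eq (actsBy_nAux hL (zero_add L.sum).le).hasRow_middle
    · have : NeZero (2 * L[ν]) := hlength (some ν)
      exact HasRow.row_eq (hasRow_nAux_some hL ν j)
  obtain ⟨P, w, hP, hw, hprod⟩ := exists_diagonalization_of_cyclic_rows
    (fun ν => Complex.isPrimitiveRoot_exp _ (hlength ν).ne) e hrow
  refine ⟨P, w, hP, hw, hprod.trans ?_⟩
  simp [Fintype.prod_option, cycleLength, c, ← Fin.prod_univ_fun_getElem]

/-! ### The numbers `σ_k` -/

section PartitionNumbers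

variable (p : ℓ.Partition)

theorem m_pos : 0 < m p := by
  refine Nat.mul_pos two_pos (Nat.pos_of_ne_zero fun h => ?_)
  exact (p.parts_pos (Multiset.lcm_eq_zero_iff _ |>.1 h)).false

theorem two_mul_dvd_m {d : ℕ} (hd : d ∈ p.parts) : 2 * d ∣ m p :=
  mul_dvd_mul_left 2 (Multiset.dvd_lcm hd)

theorem m_dvd {k : ℕ} (h2 : 2 ∣ k) (h : ∀ d ∈ p.parts, 2 * d ∣ k) : m p ∣ k := by
  obtain ⟨j, rfl⟩ := h2
  exact mul_dvd_mul_left 2 <| Multiset.lcm_dvd.2 fun d hd =>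
    Nat.dvd_of_mul_dvd_mul_left two_pos (h d hd)

theorem two_mul_half_m : 2 * (m p / 2) = m p := Nat.mul_div_cancel' ⟨_, rfl⟩

theorem card_parts_pos (hℓ : 0 < ℓ) : 0 < p.parts.card := by
  rw [Multiset.card_pos]
  rintro h
  exact hℓ.ne (by simpa only [h, Multiset.sum_zero] using p.parts_sum)

theorem card_sigmaMultiset : (sigmaMultiset p).card = ℓ := by
  have hsum : (p.parts.map fun d => d - 1).sum + p.parts.card = ℓ := by
    calc _ = (p.parts.map fun d => d - 1 + 1).sum := by simp [Multiset.sum_map_add]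
      _ = p.parts.sum := by
        rw [Multiset.map_congr rfl fun d hd => Nat.sub_add_cancel (p.parts_pos hd),
          Multiset.map_id']
      _ = ℓ := p.parts_sum
  simp only [sigmaMultiset, Multiset.card_add, Multiset.card_replicate, Multiset.card_bind,
    Function.comp_def, Multiset.card_map, Finset.card_val, Nat.card_Icc, Nat.add_sub_cancel]
  omega

variable {p} in
theorem two_mul_le_of_mem_sigmaMultiset {x : ℕ} (hx : x ∈ sigmaMultiset p) : 2 * x ≤ m p := by
  simp only [sigmaMultiset, Multiset.mem_add, Multiset.mem_bind, Multiset.mem_map,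
    Finset.mem_val, Finset.mem_Icc, Multiset.mem_replicate] at hx
  rcases hx with (⟨d, hd, a, ⟨-, had⟩, rfl⟩ | ⟨-, rfl⟩) | ⟨-, rfl⟩
  · obtain ⟨q, hq⟩ := two_mul_dvd_m p hd
    have hd0 := p.parts_pos hd
    rw [hq, mul_left_comm, Nat.mul_div_cancel_left _ (by omega), mul_assoc]
    exact Nat.mul_le_mul_left 2 (Nat.mul_le_mul_right q (by omega))
  · exact (two_mul_half_m p).le
  · exact Nat.zero_le _

theorem half_m_mem_sigmaMultiset (hℓ : 0 < ℓ) : m p / 2 ∈ sigmaMultiset p := by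
  have hcard := card_parts_pos p hℓ
  simp only [sigmaMultiset, Multiset.mem_add, Multiset.mem_replicate]
  exact .inl (.inr ⟨by omega, trivial⟩)

theorem m_dvd_of_forall_mem_sigmaMultiset (hℓ : 0 < ℓ) {k : ℕ}
    (h : ∀ x ∈ sigmaMultiset p, m p ∣ x * k) : m p ∣ k := by
  have h2 : 2 ∣ k := by
    have hpos := m_pos p
    have hhalf := two_mul_half_m p
    refine Nat.dvd_of_mul_dvd_mul_left (show 0 < m p / 2 by omega) ?_
    simpa only [mul_comm _ 2, hhalf] using h _ (half_m_mem_sigmaMultiset p hℓ)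
  refine m_dvd p h2 fun d hd => ?_
  rcases eq_or_lt_of_le (Nat.one_le_of_lt (p.parts_pos hd)) with rfl | hd1
  · exact h2
  have hmul := Nat.div_mul_cancel (two_mul_dvd_m p hd)
  have hmem : m p / (2 * d) ∈ sigmaMultiset p := by
    simp only [sigmaMultiset, Multiset.mem_add, Multiset.mem_bind, Multiset.mem_map,
      Finset.mem_val, Finset.mem_Icc]
    exact .inl (.inl ⟨d, hd, 1, ⟨le_rfl, by omega⟩, by rw [one_mul]⟩)
  refine Nat.dvd_of_mul_dvd_mul_left (Nat.pos_of_ne_zero fun h0 => ?_) (hmul.symm ▸ h _ hmem :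
    m p / (2 * d) * (2 * d) ∣ m p / (2 * d) * k)
  exact (m_pos p).ne (by rw [← hmul, h0, zero_mul])

/-- The vector `(σ₁, …, σ_ℓ)`. -/
def sigmaVec (i : Fin ℓ) : ℤ := sigma p (i + 1)

theorem ofFn_sigmaVec :
    List.ofFn (sigmaVec p) = ((sigmaMultiset p).sort (· ≥ ·)).map ((↑) : ℕ → ℤ) := by
  apply List.ext_getElem
  · simp [card_sigmaMultiset]
  · intro i hi hi'
    rw [List.length_map] at hi'
    rw [List.getElem_ofFn, List.getElem_map, sigmaVec, sigma, Nat.add_sub_cancel,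
      List.getD_eq_getElem _ _ hi']

theorem map_sigmaVec :
    Finset.univ.val.map (sigmaVec p) = (sigmaMultiset p).map ((↑) : ℕ → ℤ) := by
  rw [Fin.univ_val_map, ofFn_sigmaVec, ← Multiset.map_coe, Multiset.sort_eq]

theorem antitone_sigmaVec : Antitone (sigmaVec p) := by
  rw [← List.sortedGE_ofFn_iff, ofFn_sigmaVec]
  exact (List.pairwise_map.2 <| (Multiset.pairwise_sort (sigmaMultiset p) (· ≥ ·)).imp
    Int.ofNat_le.2).sortedGE

theorem exists_mem_sigmaMultiset_eq (i : Fin ℓ) :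
    ∃ x ∈ sigmaMultiset p, (x : ℤ) = sigmaVec p i := by
  rw [← Multiset.mem_map, ← map_sigmaVec]
  exact Multiset.mem_map_of_mem _ (Finset.mem_univ i)

theorem sigmaVec_nonneg (i : Fin ℓ) : 0 ≤ sigmaVec p i := by
  obtain ⟨x, -, h⟩ := exists_mem_sigmaMultiset_eq p i
  exact h ▸ Int.natCast_nonneg x

theorem two_mul_sigmaVec_le (i : Fin ℓ) : 2 * sigmaVec p i ≤ m p := by
  obtain ⟨x, hx, h⟩ := exists_mem_sigmaMultiset_eq p i
  have hle := two_mul_le_of_mem_sigmaMultiset hx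
  omega

variable {p} in
theorem exists_sigmaVec_eq {x : ℕ} (hx : x ∈ sigmaMultiset p) : ∃ i, sigmaVec p i = x := by
  have h := Multiset.mem_map_of_mem ((↑) : ℕ → ℤ) hx
  simpa [← map_sigmaVec] using h

end PartitionNumbers

/-! ### The characteristic polynomial of `σ(ξ)` -/

theorem prod_range_two_mul_add_one {M : Type*} [CommMonoid M] (f : ℕ → M) (k : ℕ) :
    ∏ i ∈ Finset.range (2 * k + 1), f i =
      f k * ∏ i ∈ Finset.range k, (f i * f (2 * k - i)) := by
  rw [Finset.prod_mul_distrib, two_mul, add_assoc, add_comm k (k + 1), Finset.prod_range_add,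
    Finset.prod_range_succ, ← Finset.prod_range_reflect (fun i => f (k + 1 + i)) k,
    mul_comm _ (f k), mul_assoc]
  congr 2
  refine Finset.prod_congr rfl fun i hi => congrArg f ?_
  have := Finset.mem_range.1 hi
  omega

/-- The monic quadratic polynomial with the roots `z` and `z⁻¹`. -/
noncomputable def recipQuad {F : Type*} [Field F] (z : Fˣ) : F[X] :=
  (X - C (z : F)) * (X - C ((z⁻¹ : Fˣ) : F))

section Field

variable {F : Type*} [Field F]

theorem recipQuad_one : recipQuad (1 : Fˣ) = (X - 1) ^ 2 := by
  simp only [recipQuad, inv_one, Units.val_one, map_one, pow_two]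

theorem recipQuad_neg_one : recipQuad (-1 : Fˣ) = (X + 1) ^ 2 := by
  simp only [recipQuad, inv_neg_one, Units.val_neg, Units.val_one, map_neg, map_one,
    sub_neg_eq_add, pow_two]

theorem X_pow_two_mul_sub_one_eq_prod_recipQuad {ω : Fˣ} {d : ℕ} (hd : 0 < d)
    (hω : IsPrimitiveRoot ω (2 * d)) :
    (X ^ (2 * d) - 1 : F[X]) =
      (X - 1) * (X + 1) * ∏ a ∈ Finset.Icc 1 (d - 1), recipQuad (ω ^ a) := by
  obtain ⟨e, rfl⟩ := Nat.exists_eq_add_of_le' hd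
  have hω' : IsPrimitiveRoot (ω : F) (2 * (e + 1)) := IsPrimitiveRoot.coe_units_iff.2 hω
  have hhalf : (ω : F) ^ (e + 1) = -1 :=
    (hω'.pow (by omega) (mul_comm _ _)).eq_neg_one_of_two_right
  have hinv : ∀ i ∈ Finset.range e, (ω ^ (1 + i))⁻¹ = ω ^ (2 * e - i + 1) := by
    intro i hi
    rw [Finset.mem_range] at hi
    rw [inv_eq_iff_mul_eq_one, ← pow_add, show 1 + i + (2 * e - i + 1) = 2 * (e + 1) by omega,
      hω.pow_eq_one]
  have hrecip : ∏ a ∈ Finset.Icc 1 e, recipQuad (ω ^ a) = ∏ i ∈ Finset.range e,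
      ((X - C ((ω : F) ^ (i + 1))) * (X - C ((ω : F) ^ (2 * e - i + 1)))) := by
    rw [← Finset.Ico_add_one_right_eq_Icc, Finset.prod_Ico_eq_prod_range, Nat.add_sub_cancel]
    refine Finset.prod_congr rfl fun i hi => ?_
    rw [recipQuad, hinv i hi, Units.val_pow_eq_pow_val, Units.val_pow_eq_pow_val, add_comm 1 i]
  have hprod := X_pow_sub_C_eq_prod hω' (by omega) (one_pow (2 * (e + 1)))
  simp only [mul_one, map_one] at hprod
  rw [hprod, Nat.mul_succ, Finset.prod_range_succ', prod_range_two_mul_add_one, hhalf, pow_zero,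
    Nat.add_sub_cancel, hrecip, map_neg, map_one]
  ring

end Field

theorem expo_castLE (a : Fin ℓ → ℤ) (i : Fin ℓ) (h : ℓ ≤ 2 * ℓ + 1) :
    expo a (i.castLE h) = a i := dif_pos i.2

theorem map_expo (a : Fin ℓ → ℤ) : Finset.univ.val.map (expo a) =
    0 ::ₘ (Finset.univ.val.map a + Finset.univ.val.map fun i => -a i) := by
  let e : Unit ⊕ Fin ℓ ⊕ Fin ℓ → Fin (2 * ℓ + 1) :=
    Sum.elim (fun _ => ⟨ℓ, by omega⟩)
      (Sum.elim (Fin.castLE (by omega)) fun i => (i.castLE (by omega)).rev)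
  have he : e.Bijective := by
    refine (Fintype.bijective_iff_injective_and_card e).2 ⟨?_, by simp; omega⟩
    rintro (_ | i | i) (_ | j | j) h <;>
      simp only [e, Sum.elim_inl, Sum.elim_inr, Fin.ext_iff, Fin.val_rev] at h <;> grind
  have hmid : expo a (e (.inl ())) = 0 := by simp [e, expo]
  have hleft (i : Fin ℓ) : expo a (e (.inr (.inl i))) = a i := expo_castLE a i (by omega)
  have hright (i : Fin ℓ) : expo a (e (.inr (.inr i))) = -a i := by
    rw [← hleft]
    exact expo_rev a _
  rw [← Multiset.map_univ_val_equiv (Equiv.ofBijective e he), Multiset.map_map,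
    ← Finset.univ_disjSum_univ, Finset.val_disjSum, ← Finset.univ_disjSum_univ,
    Finset.val_disjSum, Multiset.disjSum, Multiset.disjSum]
  simp only [Multiset.map_add, Multiset.map_map, Function.comp_def, Equiv.ofBijective_apply,
    hmid, hleft, hright]
  rfl

theorem prod_X_sub_C_zpow_expo (a : Fin ℓ → ℤ) (z : ℂˣ) :
    ∏ i, (X - C ((z ^ expo a i : ℂˣ) : ℂ)) =
      (X - 1) * ((Finset.univ.val.map a).map fun s => recipQuad (z ^ s)).prod := by
  have h := congrArg (fun S => (S.map fun s => X - C ((z ^ s : ℂˣ) : ℂ)).prod) (map_expo a)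
  simp only [Multiset.map_cons, Multiset.map_add, Multiset.prod_cons, Multiset.prod_add,
    Multiset.map_map, Function.comp_def, zpow_zero, Units.val_one, map_one] at h
  simp only [recipQuad, ← _root_.zpow_neg, Multiset.prod_map_mul, Multiset.map_map,
    Function.comp_def]
  exact h

/-- The middle eigenvalue `1` with `⌈μ/2⌉` pairs `-1, -1` and `⌊μ/2⌋` pairs `1, 1` amounts to the
middle eigenvalue `(-1)^μ` with `μ` pairs `1, -1`. -/
theorem sub_one_mul_pow_mul_pow_eq {R : Type*} [CommRing R] (x : R) (μ : ℕ) :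
    (x - 1) * (((x + 1) ^ 2) ^ ((μ + 1) / 2) * ((x - 1) ^ 2) ^ (μ / 2)) =
      (x - (-1) ^ μ) * ((x - 1) * (x + 1)) ^ μ := by
  rcases Nat.even_or_odd' μ with ⟨k, rfl | rfl⟩
  · rw [show (2 * k + 1) / 2 = k by omega, show 2 * k / 2 = k by omega,
      (even_two_mul k).neg_one_pow, mul_comm (x - 1) (x + 1), mul_pow, pow_mul, pow_mul]
  · rw [show (2 * k + 1 + 1) / 2 = k + 1 by omega, show (2 * k + 1) / 2 = k by omega,
      (odd_two_mul_add_one k).neg_one_pow, sub_neg_eq_add]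
    generalize x - 1 = u, x + 1 = v
    ring

section Partition

variable (p : ℓ.Partition)

theorem prod_map_recipQuad_sigmaMultiset {ξ : ℂˣ} (hξ : IsPrimitiveRoot ξ (m p)) :
    ((sigmaMultiset p).map fun x => recipQuad (ξ ^ x)).prod =
      (p.parts.map fun d => ∏ a ∈ Finset.Icc 1 (d - 1), recipQuad ((ξ ^ (m p / (2 * d))) ^ a)).prod
        * (((X + 1) ^ 2) ^ ((p.parts.card + 1) / 2) * ((X - 1) ^ 2) ^ (p.parts.card / 2)) := by
  have hhalf : ξ ^ (m p / 2) = -1 := by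
    refine Units.ext (?_ : ((ξ ^ (m p / 2) : ℂˣ) : ℂ) = -1)
    rw [Units.val_pow_eq_pow_val]
    exact ((IsPrimitiveRoot.coe_units_iff.2 hξ).pow (m_pos p)
      (mul_comm 2 _ ▸ (two_mul_half_m p).symm)).eq_neg_one_of_two_right
  have hparts : ∀ d ∈ p.parts, (Finset.Icc 1 (d - 1)).val.map
      (fun a => recipQuad (ξ ^ (a * m p / (2 * d)))) =
      (Finset.Icc 1 (d - 1)).val.map fun a => recipQuad ((ξ ^ (m p / (2 * d))) ^ a) := by
    intro d hd
    refine Multiset.map_congr rfl fun a _ => ?_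
    rw [Nat.mul_div_assoc a (two_mul_dvd_m p hd), mul_comm, pow_mul]
  simp only [sigmaMultiset, Multiset.map_add, Multiset.prod_add, Multiset.map_bind,
    Multiset.prod_bind, Multiset.map_map, Multiset.map_replicate, Multiset.prod_replicate,
    Function.comp_def, pow_zero, recipQuad_one, hhalf, recipQuad_neg_one, mul_assoc]
  rw [Multiset.map_congr rfl fun d hd => congrArg Multiset.prod (hparts d hd)]
  rfl

theorem prod_X_sub_C_zpow_expo_sigmaVec {ξ : ℂˣ} (hξ : IsPrimitiveRoot ξ (m p)) :
    ∏ i, (X - C ((ξ ^ expo (sigmaVec p) i : ℂˣ) : ℂ)) =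
      (X - C ((-1) ^ p.parts.card)) * (p.parts.map fun d => (X ^ (2 * d) - 1 : ℂ[X])).prod := by
  have hparts : ∀ d ∈ p.parts, (X ^ (2 * d) - 1 : ℂ[X]) = (X - 1) * (X + 1) *
      ∏ a ∈ Finset.Icc 1 (d - 1), recipQuad ((ξ ^ (m p / (2 * d))) ^ a) := fun d hd =>
    X_pow_two_mul_sub_one_eq_prod_recipQuad (p.parts_pos hd)
      (hξ.pow (m_pos p) (Nat.div_mul_cancel (two_mul_dvd_m p hd)).symm)
  rw [prod_X_sub_C_zpow_expo, map_sigmaVec, Multiset.map_map]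
  simp only [Function.comp_def, zpow_natCast]
  rw [prod_map_recipQuad_sigmaMultiset p hξ, Multiset.map_congr rfl hparts,
    Multiset.prod_map_mul, Multiset.map_const', Multiset.prod_replicate, mul_left_comm,
    sub_one_mul_pow_mul_pow_eq, map_pow, map_neg, map_one]
  ring

end Partition

/-! ### Conjugation of `n` into the torus -/

theorem exists_equiv_of_map_eq {ι κ α : Type*} [Fintype ι] [Fintype κ] {f : ι → α} {g : κ → α}
    (h : Finset.univ.val.map f = Finset.univ.val.map g) : ∃ e : ι ≃ κ, g ∘ e = f := by
  classical
  have hfiber (z : α) : Nonempty ({i // f i = z} ≃ {k // g k = z}) := by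
    have hcount := congrArg (Multiset.count z) h
    rw [Multiset.count_map, Multiset.count_map] at hcount
    rw [← Fintype.card_eq, Fintype.card_subtype, Fintype.card_subtype]
    simpa only [Finset.card_def, Finset.filter_val, eq_comm] using hcount
  exact ⟨Equiv.ofFiberEquiv fun z => (hfiber z).some, funext (Equiv.ofFiberEquiv_map _)⟩

theorem map_eq_of_prod_X_sub_C_eq {ι κ R : Type*} [Fintype ι] [Fintype κ] [CommRing R] [IsDomain R]
    {f : ι → R} {g : κ → R} (h : ∏ i, (X - C (f i)) = ∏ k, (X - C (g k))) :
    Finset.univ.val.map f = Finset.univ.val.map g := by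
  have hprod : ((Finset.univ.val.map f).map fun z => X - C z).prod =
      ((Finset.univ.val.map g).map fun z => X - C z).prod := by
    rw [Multiset.map_map, Multiset.map_map]
    exact h
  rw [← roots_multiset_prod_X_sub_C (Finset.univ.val.map f), hprod, roots_multiset_prod_X_sub_C]

theorem exists_conj_eq_coch_of_diagonalization {g : SO ℓ} {P : Mat ℓ} {w : Fin (2 * ℓ + 1) → ℂ}
    (hP : IsUnit P) (hgP : toMat g * P = P * diagonal w) {a : Fin ℓ → ℤ} {z : ℂˣ}
    (hw : ∏ i, (X - C (w i)) = ∏ i, (X - C ((z ^ expo a i : ℂˣ) : ℂ))) :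
    ∃ h : SO ℓ, h⁻¹ * g * h = coch a z := by
  obtain ⟨e, he⟩ := exists_equiv_of_map_eq (map_eq_of_prod_X_sub_C_eq hw.symm)
  refine exists_conj_of_toMat_mul_eq (P := P.submatrix id e)
    ((isUnit_submatrix_equiv (Equiv.refl _) e).2 hP) ?_
  calc toMat g * P.submatrix id e = (P * diagonal w).submatrix id e := by rw [← hgP]; rfl
    _ = P.submatrix id e * toMat (coch a z) := by
      rw [toMat_coch, ← submatrix_mul_equiv P (diagonal w) id e e, submatrix_diagonal_equiv, he]

theorem exists_conj_n_eq_coch (p : ℓ.Partition) {ξ : ℂˣ} (hξ : IsPrimitiveRoot ξ (m p)) :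
    ∃ h : SO ℓ, h⁻¹ * n p * h = coch (sigmaVec p) ξ := by
  have hparts : ((p.parts.sort (· ≤ ·) : List ℕ) : Multiset ℕ) = p.parts := Multiset.sort_eq _ _
  obtain ⟨P, w, hP, hnP, hw⟩ := exists_diagonalization_nAux (ℓ := ℓ) (L := p.parts.sort (· ≤ ·))
    (fun d hd => p.parts_pos ((Multiset.mem_sort _).1 hd))
    (by rw [← Multiset.sum_coe, hparts, p.parts_sum])
  refine exists_conj_eq_coch_of_diagonalization hP hnP (hw.trans ?_)
  rw [prod_X_sub_C_zpow_expo_sigmaVec p hξ, ← Multiset.coe_card, ← Multiset.prod_coe,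
    ← Multiset.map_coe, hparts]

theorem zpow_eq_one_of_coch_eq_one {a : Fin ℓ → ℤ} {z : ℂˣ} (h : coch a z = 1) (i : Fin ℓ) :
    z ^ a i = 1 := by
  rw [← toMat_injective.eq_iff, toMat_coch, map_one, ← diagonal_one, diagonal_injective.eq_iff]
    at h
  have hi := congrFun h (i.castLE (by omega))
  rwa [Units.val_eq_one, expo_castLE] at hi

theorem orderOf_coch_sigmaVec (hℓ : 0 < ℓ) (p : ℓ.Partition) {ξ : ℂˣ}
    (hξ : IsPrimitiveRoot ξ (m p)) : orderOf (coch (sigmaVec p) ξ) = m p := by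
  refine Nat.dvd_antisymm (orderOf_dvd_of_pow_eq_one ?_)
    (m_dvd_of_forall_mem_sigmaMultiset p hℓ fun x hx => ?_)
  · rw [← map_pow, hξ.pow_eq_one, map_one]
  · have hone := pow_orderOf_eq_one (coch (sigmaVec p) ξ)
    rw [← map_pow] at hone
    obtain ⟨i, hi⟩ := exists_sigmaVec_eq hx
    rw [← hξ.pow_eq_one_iff_dvd, mul_comm, pow_mul, ← zpow_natCast _ x, ← hi,
      zpow_eq_one_of_coch_eq_one hone]

theorem orderOf_n (hℓ : 0 < ℓ) (p : ℓ.Partition) {ξ : ℂˣ} (hξ : IsPrimitiveRoot ξ (m p)) :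
    orderOf (n p) = m p := by
  obtain ⟨h, hh⟩ := exists_conj_n_eq_coch p hξ
  have hconj := (MulAut.conj h⁻¹).orderOf_eq (n p)
  rwa [MulAut.conj_apply, inv_inv, hh, orderOf_coch_sigmaVec hℓ p hξ, eq_comm] at hconj

theorem map_zpow_expo_eq_of_conj {a c : Fin ℓ → ℤ} {ξ : ℂˣ} {h : SO ℓ}
    (hh : h⁻¹ * coch a ξ * h = coch c ξ) :
    Finset.univ.val.map (fun i => ξ ^ expo a i) = Finset.univ.val.map fun i => ξ ^ expo c i := by
  have hcharpoly : (toMat (coch a ξ)).charpoly = (toMat (coch c ξ)).charpoly := by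
    rw [← hh, map_mul, charpoly_mul_comm, ← map_mul, mul_inv_cancel_left]
  rw [toMat_coch, toMat_coch, charpoly_diagonal, charpoly_diagonal] at hcharpoly
  refine Multiset.map_injective Units.val_injective ?_
  rw [Multiset.map_map, Multiset.map_map]
  exact map_eq_of_prod_X_sub_C_eq hcharpoly

/-! ### The alcove -/

/-- The value at `x` of the affine root attached to a node of the affine diagram: `1 - γ̃₀` for
the affine node and `γ_k` for the others. -/
def affineRoot (k : Fin (ℓ + 1)) (x : Fin ℓ → ℝ) : ℝ :=
  Fin.cases (1 - highestRoot ℓ ⬝ᵥ x) (fun k => simpleRoot k ⬝ᵥ x) k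

theorem affineRoot_zero (x : Fin ℓ → ℝ) : affineRoot 0 x = 1 - highestRoot ℓ ⬝ᵥ x := rfl

theorem affineRoot_succ (k : Fin ℓ) (x : Fin ℓ → ℝ) : affineRoot k.succ x = simpleRoot k ⬝ᵥ x :=
  rfl

theorem mem_closedAlcove_iff {x : Fin ℓ → ℝ} : x ∈ closedAlcove ℓ ↔ ∀ k, 0 ≤ affineRoot k x := by
  rw [Fin.forall_fin_succ, affineRoot_zero, sub_nonneg, and_comm]
  rfl

theorem simpleRoot_dotProduct (k : Fin ℓ) (x : Fin ℓ → ℝ) :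
    simpleRoot k ⬝ᵥ x = if h : (k : ℕ) + 1 < ℓ then x k - x ⟨k + 1, h⟩ else x k := by
  unfold simpleRoot
  split_ifs with h
  · rw [sub_dotProduct, single_one_dotProduct, single_one_dotProduct]
  · rw [single_one_dotProduct]

theorem simpleRoot_dotProduct_coweight (k j : Fin ℓ) :
    simpleRoot k ⬝ᵥ coweight j = if k = j then 1 else 0 := by
  simp only [simpleRoot_dotProduct, coweight]
  grind

theorem sum_simpleRoot_dotProduct_mul_coweight (x : Fin ℓ → ℝ) (i : Fin ℓ) :
    ∑ k, simpleRoot k ⬝ᵥ x * coweight k i = x i := by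
  have hdual : of simpleRoot * (of coweight)ᵀ = (1 : Matrix (Fin ℓ) (Fin ℓ) ℝ) := by
    ext k j
    rw [one_apply, ← simpleRoot_dotProduct_coweight]
    rfl
  calc ∑ k, simpleRoot k ⬝ᵥ x * coweight k i
      = ((of coweight)ᵀ *ᵥ of simpleRoot *ᵥ x) i :=
        Finset.sum_congr rfl fun k _ => mul_comm _ _
    _ = x i := by rw [mulVec_mulVec, mul_eq_one_comm.1 hdual, one_mulVec]

theorem highestRoot_dotProduct (hℓ : 2 ≤ ℓ) (x : Fin ℓ → ℝ) :
    highestRoot ℓ ⬝ᵥ x = x ⟨0, by omega⟩ + x ⟨1, hℓ⟩ := by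
  have hb (k : Fin ℓ) : (b k.succ : ℝ) = 2 * coweight k ⟨0, by omega⟩ -
      if k = ⟨0, by omega⟩ then 1 else 0 := by
    simp only [b, coweight, Fin.val_succ, Fin.le_def, Fin.ext_iff]
    split_ifs <;> norm_num <;> omega
  have hsimple : simpleRoot ⟨0, by omega⟩ ⬝ᵥ x = x ⟨0, by omega⟩ - x ⟨1, hℓ⟩ :=
    (simpleRoot_dotProduct _ x).trans (dif_pos hℓ)
  calc highestRoot ℓ ⬝ᵥ x
      = 2 * ∑ k, simpleRoot k ⬝ᵥ x * coweight k ⟨0, by omega⟩ -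
          simpleRoot ⟨0, by omega⟩ ⬝ᵥ x := by
        simp only [highestRoot, sum_dotProduct, smul_dotProduct, smul_eq_mul, hb, sub_mul,
          Finset.sum_sub_distrib, ite_mul, one_mul, zero_mul, Finset.sum_ite_eq', Finset.mem_univ,
          if_true, Finset.mul_sum, mul_assoc, mul_comm (coweight _ _)]
    _ = x ⟨0, by omega⟩ + x ⟨1, hℓ⟩ := by
        rw [sum_simpleRoot_dotProduct_mul_coweight, hsimple]
        ring

theorem b_pos (k : Fin (ℓ + 1)) : 0 < b k := by
  unfold b
  split_ifs <;> norm_num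

theorem sum_b_mul_affineRoot (x : Fin ℓ → ℝ) : ∑ k, b k * affineRoot k x = 1 := by
  rw [Fin.sum_univ_succ, affineRoot_zero, highestRoot, sum_dotProduct]
  simp only [affineRoot_succ, smul_dotProduct, smul_eq_mul]
  rw [show b (0 : Fin (ℓ + 1)) = 1 from rfl, Nat.cast_one, one_mul, sub_add_cancel]

theorem sum_smul_vertex (t : Fin (ℓ + 1) → ℝ) :
    ∑ k, t k • vertex k = ∑ k : Fin ℓ, (t k.succ / b k.succ) • coweight k := by
  rw [Fin.sum_univ_succ, show vertex (0 : Fin (ℓ + 1)) = 0 from rfl, smul_zero, zero_add]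
  refine Finset.sum_congr rfl fun k _ => ?_
  rw [show vertex k.succ = (1 / (b k.succ : ℝ)) • coweight k from rfl, smul_smul, mul_one_div]

theorem eq_sum_smul_vertex_iff {x : Fin ℓ → ℝ} {t : Fin (ℓ + 1) → ℝ} :
    x = ∑ k, t k • vertex k ∧ ∑ k, t k = 1 ↔ ∀ k, t k = b k * affineRoot k x := by
  have hb (k : Fin (ℓ + 1)) : (b k : ℝ) ≠ 0 := Nat.cast_ne_zero.2 (b_pos k).ne'
  constructor
  · rintro ⟨hx, ht⟩
    have hsucc (k : Fin ℓ) : t k.succ = b k.succ * affineRoot k.succ x := by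
      rw [affineRoot_succ, hx, sum_smul_vertex, dotProduct_sum]
      simp only [dotProduct_smul, simpleRoot_dotProduct_coweight, smul_eq_mul, mul_ite, mul_one,
        mul_zero, Finset.sum_ite_eq, Finset.mem_univ, if_true]
      field_simp [hb k.succ]
    refine Fin.cases ?_ hsucc
    have hsum := ht.trans (sum_b_mul_affineRoot x).symm
    rwa [Fin.sum_univ_succ, Fin.sum_univ_succ, Finset.sum_congr rfl fun k _ => hsucc k,
      add_left_inj] at hsum
  · intro h
    refine ⟨?_, by simp only [h, sum_b_mul_affineRoot]⟩
    ext i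
    rw [sum_smul_vertex, Finset.sum_apply, ← sum_simpleRoot_dotProduct_mul_coweight x i]
    refine Finset.sum_congr rfl fun k _ => ?_
    rw [h, mul_div_cancel_left₀ _ (hb _)]
    rfl

theorem eq_sum_div_smul_vertex_iff {x : Fin ℓ → ℝ} {r : Fin (ℓ + 1) → ℤ} {M : ℕ} (hM : 0 < M) :
    x = ∑ k, ((r k : ℝ) * b k / M) • vertex k ∧ (M : ℤ) = ∑ k, r k * b k ↔
      ∀ k, (r k : ℝ) = M * affineRoot k x := by
  have hM' : (M : ℝ) ≠ 0 := Nat.cast_ne_zero.2 hM.ne'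
  have hsum : (M : ℤ) = ∑ k, r k * b k ↔ ∑ k, (r k : ℝ) * b k / M = 1 := by
    rw [← Finset.sum_div, div_eq_one_iff_eq hM', eq_comm, ← Int.cast_inj (α := ℝ)]
    push_cast
    rfl
  rw [hsum, eq_sum_smul_vertex_iff]
  refine forall_congr' fun k => ?_
  have hb : (b k : ℝ) ≠ 0 := Nat.cast_ne_zero.2 (b_pos k).ne'
  rw [div_eq_iff hM', mul_comm _ (b k : ℝ), mul_assoc, mul_right_inj' hb, mul_comm (M : ℝ)]

theorem antitone_coweight (k : Fin ℓ) : Antitone (coweight k) := by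
  intro i j hij
  simp only [coweight]
  grind

theorem coweight_nonneg (k i : Fin ℓ) : 0 ≤ coweight k i := by
  simp only [coweight]
  split_ifs <;> norm_num

theorem mem_closedAlcove_iff_antitone (hℓ : 2 ≤ ℓ) {x : Fin ℓ → ℝ} :
    x ∈ closedAlcove ℓ ↔ Antitone x ∧ (∀ i, 0 ≤ x i) ∧ x ⟨0, by omega⟩ + x ⟨1, hℓ⟩ ≤ 1 := by
  refine ⟨fun ⟨hsimple, hhighest⟩ => ⟨fun i j hij => ?_, fun i => ?_, ?_⟩,
    fun ⟨hanti, hnonneg, hle⟩ => ⟨fun k => ?_, ?_⟩⟩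
  · rw [← sum_simpleRoot_dotProduct_mul_coweight x i, ← sum_simpleRoot_dotProduct_mul_coweight x j]
    exact Finset.sum_le_sum fun k _ =>
      mul_le_mul_of_nonneg_left (antitone_coweight k hij) (hsimple k)
  · rw [← sum_simpleRoot_dotProduct_mul_coweight x i]
    exact Finset.sum_nonneg fun k _ => mul_nonneg (hsimple k) (coweight_nonneg k i)
  · rwa [← highestRoot_dotProduct]
  · rw [simpleRoot_dotProduct]
    split_ifs with h
    · exact sub_nonneg.2 (hanti (Fin.le_def.2 (Nat.le_succ k)))
    · exact hnonneg k
  · rwa [highestRoot_dotProduct hℓ]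

section Partition

variable (p : ℓ.Partition)

theorem sigmaVec_div_mem_closedAlcove (hℓ : 2 ≤ ℓ) :
    (fun i => (sigmaVec p i : ℝ) / m p) ∈ closedAlcove ℓ := by
  have hm : (0 : ℝ) < m p := Nat.cast_pos.2 (m_pos p)
  have hle (i : Fin ℓ) : 2 * (sigmaVec p i : ℝ) ≤ m p := mod_cast two_mul_sigmaVec_le p i
  refine (mem_closedAlcove_iff_antitone hℓ).2 ⟨fun i j hij => ?_, fun i => ?_, ?_⟩
  · exact div_le_div_of_nonneg_right (Int.cast_le.2 (antitone_sigmaVec p hij)) hm.le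
  · exact div_nonneg (Int.cast_nonneg (sigmaVec_nonneg p i)) hm.le
  · rw [← add_div, div_le_one hm]
    linarith [hle ⟨0, by omega⟩, hle ⟨1, hℓ⟩]

theorem labels_eq_m_mul_affineRoot (hℓ : 2 ≤ ℓ) (k : Fin (ℓ + 1)) :
    (labels p k : ℝ) = m p * affineRoot k fun i => (sigmaVec p i : ℝ) / m p := by
  have hm : (m p : ℝ) ≠ 0 := Nat.cast_ne_zero.2 (m_pos p).ne'
  refine Fin.cases ?_ (fun k => ?_) k
  · rw [affineRoot_zero, highestRoot_dotProduct hℓ]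
    field_simp
    simp [labels, sigmaVec]
  · rw [affineRoot_succ, simpleRoot_dotProduct]
    simp only [labels, Fin.val_succ, Nat.succ_ne_zero, if_false, sigmaVec]
    split_ifs with h
    · field_simp
      push_cast
      rfl
    · rw [show (k : ℕ) + 1 = ℓ by omega]
      field_simp

end Partition

/-! ### Uniqueness of the point of the alcove -/

theorem le_half_of_mem_closedAlcove (hℓ : 2 ≤ ℓ) {x : Fin ℓ → ℝ} (hx : x ∈ closedAlcove ℓ)
    {j : Fin ℓ} {q : ℤ} (hj : x j = q + 1 / 2) (i : Fin ℓ) : x i ≤ 1 / 2 := by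
  obtain ⟨hanti, hnonneg, hle⟩ := (mem_closedAlcove_iff_antitone hℓ).1 hx
  have hmax (k : Fin ℓ) : x k ≤ x ⟨0, by omega⟩ := hanti (Fin.le_def.2 (Nat.zero_le _))
  have hq : x j = 1 / 2 := by
    have hlower : (-1 : ℝ) < q := by linarith [hnonneg j]
    have hupper : (q : ℝ) < 1 := by linarith [hmax j, hnonneg ⟨1, hℓ⟩]
    have hlower' : -1 < q := mod_cast hlower
    have hupper' : q < 1 := mod_cast hupper
    rw [hj, show q = 0 by omega, Int.cast_zero, zero_add]
  rcases Nat.eq_zero_or_pos j with hj0 | hj0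
  · rw [← hq, show j = ⟨0, by omega⟩ from Fin.ext hj0]
    exact hmax i
  · have hj1 : x j ≤ x ⟨1, hℓ⟩ := hanti (Fin.le_def.2 hj0)
    linarith [hmax i]

section Field

variable {F : Type*} [Field F]

theorem eq_or_mul_eq_one_of_add_inv_eq {z w : F} (hz : z ≠ 0) (hw : w ≠ 0)
    (h : z + z⁻¹ = w + w⁻¹) : z = w ∨ z * w = 1 := by
  field_simp at h
  have hfactor : (z - w) * (z * w - 1) = 0 := by linear_combination h
  exact (mul_eq_zero.1 hfactor).imp sub_eq_zero.1 sub_eq_zero.1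

theorem injOn_zpow_add_inv {ξ : Fˣ} {M : ℕ} (hξ : IsPrimitiveRoot ξ M) :
    Set.InjOn (fun s : ℤ => (ξ ^ s : Fˣ) + ((ξ ^ s : Fˣ) : F)⁻¹) {s | 0 ≤ s ∧ 2 * s ≤ M} := by
  rintro x ⟨hx, hxM⟩ y ⟨hy, hyM⟩ h
  rcases eq_or_mul_eq_one_of_add_inv_eq (Units.ne_zero _) (Units.ne_zero _) h with h | h
  · have hdvd : (M : ℤ) ∣ x - y := by
      rw [← hξ.zpow_eq_one_iff_dvd, _root_.zpow_sub, Units.ext h, mul_inv_cancel]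
    by_contra hne
    have := Int.le_of_dvd (abs_pos.2 (sub_ne_zero.2 hne)) ((dvd_abs _ _).2 hdvd)
    grind
  · have hdvd : (M : ℤ) ∣ x + y := by
      rw [← hξ.zpow_eq_one_iff_dvd, _root_.zpow_add]
      exact Units.ext h
    by_contra hne
    have := Int.le_of_dvd (by omega) hdvd
    omega

theorem map_eq_of_map_zpow_expo_eq {ξ : Fˣ} {M : ℕ} (hξ : IsPrimitiveRoot ξ M) {a c : Fin ℓ → ℤ}
    (ha : ∀ i, 0 ≤ a i ∧ 2 * a i ≤ M) (hc : ∀ i, 0 ≤ c i ∧ 2 * c i ≤ M)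
    (h : Finset.univ.val.map (fun i => ξ ^ expo a i) =
      Finset.univ.val.map fun i => ξ ^ expo c i) :
    Finset.univ.val.map a = Finset.univ.val.map c := by
  classical
  let f (s : ℤ) : F := (ξ ^ s : Fˣ) + ((ξ ^ s : Fˣ) : F)⁻¹
  have hneg (s : ℤ) : f (-s) = f s := by
    simp only [f, _root_.zpow_neg, Units.val_inv_eq_inv_val, inv_inv, add_comm]
  have hexpo (a : Fin ℓ → ℤ) : Finset.univ.val.map (fun i => f (expo a i)) =
      f 0 ::ₘ (2 • Finset.univ.val.map fun i => f (a i)) := by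
    have := congrArg (Multiset.map f) (map_expo a)
    simpa only [Multiset.map_cons, Multiset.map_add, Multiset.map_map, Function.comp_def, hneg,
      ← two_nsmul] using this
  have hdouble : 2 • Finset.univ.val.map (fun i => f (a i)) =
      2 • Finset.univ.val.map fun i => f (c i) := by
    rw [← Multiset.cons_inj_right (f 0), ← hexpo, ← hexpo]
    have := congrArg (Multiset.map fun z : Fˣ => (z : F) + (z : F)⁻¹) h
    rwa [Multiset.map_map, Multiset.map_map] at this
  have hmap : Finset.univ.val.map (fun i => f (a i)) = Finset.univ.val.map fun i => f (c i) := by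
    ext z
    have := congrArg (Multiset.count z) hdouble
    rwa [Multiset.count_nsmul, Multiset.count_nsmul, mul_right_inj' two_ne_zero] at this
  obtain ⟨e, he⟩ := exists_equiv_of_map_eq hmap
  have hce : c ∘ e = a := funext fun i =>
    injOn_zpow_add_inv hξ (hc (e i)) (ha i) (congrFun he i)
  rw [← hce, ← Multiset.map_map, Multiset.map_univ_val_equiv]

end Field

theorem eq_of_antitone_of_map_eq {n : ℕ} {α : Type*} [PartialOrder α] {a c : Fin n → α}
    (ha : Antitone a) (hc : Antitone c)
    (h : Finset.univ.val.map a = Finset.univ.val.map c) : a = c := by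
  rw [Fin.univ_val_map, Fin.univ_val_map, Multiset.coe_eq_coe] at h
  exact List.ofFn_injective (h.eq_of_pairwise'
    (List.sortedGE_ofFn_iff.2 ha).pairwise (List.sortedGE_ofFn_iff.2 hc).pairwise)

theorem exists_div_eq_add_half_of_map_zpow_expo_eq (hℓ : 0 < ℓ) {p : ℓ.Partition}
    {F : Type*} [Field F] {ξ : Fˣ} (hξ : IsPrimitiveRoot ξ (m p)) {a : Fin ℓ → ℤ}
    (h : Finset.univ.val.map (fun i => ξ ^ expo a i) =
      Finset.univ.val.map fun i => ξ ^ expo (sigmaVec p) i) :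
    ∃ (j : Fin ℓ) (q : ℤ), (a j : ℝ) / m p = q + 1 / 2 := by
  have hm : (m p : ℤ) ≠ 0 := Nat.cast_ne_zero.2 (m_pos p).ne'
  suffices ∃ (j : Fin ℓ) (q : ℤ), 2 * a j = m p * (2 * q + 1) by
    obtain ⟨j, q, hq⟩ := this
    have hq' : 2 * (a j : ℝ) = m p * (2 * q + 1) := mod_cast hq
    refine ⟨j, q, ?_⟩
    rw [div_eq_iff (Nat.cast_ne_zero.2 (m_pos p).ne')]
    linarith
  obtain ⟨j, hj⟩ := exists_sigmaVec_eq (half_m_mem_sigmaMultiset p hℓ)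
  have hmem : ξ ^ ((m p / 2 : ℕ) : ℤ) ∈ Finset.univ.val.map fun i => ξ ^ expo a i := by
    rw [h, ← hj, ← expo_castLE (sigmaVec p) j (by omega)]
    exact Multiset.mem_map_of_mem _ (Finset.mem_univ_val _)
  obtain ⟨i, -, hi⟩ := Multiset.mem_map.1 hmem
  obtain ⟨q, hq⟩ : (m p : ℤ) ∣ expo a i - (m p / 2 : ℕ) := by
    rw [← hξ.zpow_eq_one_iff_dvd, _root_.zpow_sub, hi, mul_inv_cancel]
  have hhalf : 2 * ((m p / 2 : ℕ) : ℤ) = m p := mod_cast two_mul_half_m p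
  have hodd : 2 * expo a i = m p * (2 * q + 1) := by linear_combination 2 * hq + hhalf
  have hexpo : expo a i ∈ Finset.univ.val.map (expo a) :=
    Multiset.mem_map_of_mem _ (Finset.mem_univ_val _)
  simp only [map_expo, Multiset.mem_cons, Multiset.mem_add, Multiset.mem_map, Finset.mem_val,
    Finset.mem_univ, true_and] at hexpo
  rcases hexpo with hzero | ⟨k, hk⟩ | ⟨k, hk⟩
  · rw [hzero, mul_zero, zero_eq_mul] at hodd
    omega
  · exact ⟨k, q, by rw [hk, hodd]⟩
  · exact ⟨k, -q - 1, by linear_combination -hodd - 2 * hk⟩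

theorem eq_sigmaVec_of_conj (hℓ : 2 ≤ ℓ) {p : ℓ.Partition} {ξ : ℂˣ}
    (hξ : IsPrimitiveRoot ξ (m p)) {a : Fin ℓ → ℤ}
    (ha : (fun i => (a i : ℝ) / m p) ∈ closedAlcove ℓ) {h : SO ℓ}
    (hh : h⁻¹ * coch a ξ * h = coch (sigmaVec p) ξ) : a = sigmaVec p := by
  have hm : (0 : ℝ) < m p := Nat.cast_pos.2 (m_pos p)
  have hmap := map_zpow_expo_eq_of_conj hh
  obtain ⟨j, q, hj⟩ := exists_div_eq_add_half_of_map_zpow_expo_eq (by omega) hξ hmap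
  obtain ⟨hanti, hnonneg, -⟩ := (mem_closedAlcove_iff_antitone hℓ).1 ha
  have hrange (i : Fin ℓ) : 0 ≤ a i ∧ 2 * a i ≤ m p := by
    have hlower := hnonneg i
    have hupper := le_half_of_mem_closedAlcove hℓ ha hj i
    rw [le_div_iff₀ hm, zero_mul] at hlower
    rw [div_le_iff₀ hm] at hupper
    have hupper' : 2 * (a i : ℝ) ≤ m p := by linarith
    exact ⟨mod_cast hlower, mod_cast hupper'⟩
  refine eq_of_antitone_of_map_eq (fun i k hik => ?_) (antitone_sigmaVec p)
    (map_eq_of_map_zpow_expo_eq hξ hrange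
      (fun i => ⟨sigmaVec_nonneg p i, two_mul_sigmaVec_le p i⟩) hmap)
  exact Int.cast_le.1 ((div_le_div_iff_of_pos_right hm).1 (hanti hik))

end KacB

theorem mainTheorem5_general (ℓ : ℕ) (hℓ : 2 ≤ ℓ) (p : ℓ.Partition)
    (ξ : ℂˣ) (hξ : IsPrimitiveRoot ξ (KacB.m p)) (y : Fin (ℓ + 1) → ℤ) :
    KacB.IsKacDiagram ξ (KacB.n p) y ↔ y = KacB.reduce (KacB.labels p) := by
  have hm := KacB.m_pos p
  have hlabels := KacB.labels_eq_m_mul_affineRoot p hℓ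
  have halcove := KacB.sigmaVec_div_mem_closedAlcove p hℓ
  obtain ⟨h₀, hh₀⟩ := KacB.exists_conj_n_eq_coch p hξ
  rw [KacB.IsKacDiagram, KacB.orderOf_n (by omega) p hξ]
  constructor
  · rintro ⟨-, -, h, a, r, hh, ha, -, hx, hsum, rfl⟩
    have hconj : (h⁻¹ * h₀)⁻¹ * KacB.coch a ξ * (h⁻¹ * h₀) = KacB.coch (KacB.sigmaVec p) ξ := by
      rw [← hh, ← hh₀]
      group
    obtain rfl := KacB.eq_sigmaVec_of_conj hℓ hξ ha hconj
    have hr := (KacB.eq_sum_div_smul_vertex_iff hm).1 ⟨hx, hsum⟩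
    exact congrArg KacB.reduce (funext fun k => Int.cast_injective ((hr k).trans (hlabels k).symm))
  · rintro rfl
    obtain ⟨hx, hsum⟩ := (KacB.eq_sum_div_smul_vertex_iff hm).2 hlabels
    have hnonneg (k : Fin (ℓ + 1)) : 0 ≤ KacB.labels p k := by
      rw [← Int.cast_nonneg_iff (R := ℝ), hlabels]
      exact mul_nonneg (Nat.cast_nonneg _) (KacB.mem_closedAlcove_iff.1 halcove k)
    exact ⟨hm, hξ, h₀, KacB.sigmaVec p, KacB.labels p, hh₀, halcove, hnonneg, hx, hsum, rfl⟩

theorem mainTheorem5 (ℓ : ℕ) (hℓ : 3 ≤ ℓ) (p : ℓ.Partition)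
    (ξ : ℂˣ) (hξ : IsPrimitiveRoot ξ (KacB.m p)) (y : Fin (ℓ + 1) → ℤ) :
    KacB.IsKacDiagram ξ (KacB.n p) y ↔ y = KacB.reduce (KacB.labels p) :=
  mainTheorem5_general ℓ (Nat.le_of_succ_le hℓ) p ξ hξ y
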